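/- Let $\mathfrak g$ be a finite-dimensional complex simple Lie algebra, $\mathfrak h$ a Cartan subalgebra, $\Delta$ the set of roots, $\Pi\subset\Delta$ a set of simple roots, $\Delta_+$ the positive roots and $\psi$ the highest root. For $\varphi\in\Delta$ write $\varphi=\sum_{\alpha\in\Pi}n_\alpha(\varphi)\,\alpha$ with $n_\alpha(\varphi)\in\mathbb Z$, and let $e_\varphi$ be a root vector. Let $\mathfrak q\ne\mathfrak g$ be a proper standard parabolic subalgebra, that is, a Lie subalgebra containing the Borel subalgebra $\mathfrak b=\mathfrak h+\sum_{\varphi\in\Delta_+}\mathbb C e_\varphi$. Let $\mathfrak n$ be the nilradical of $\mathfrak q$, let $\mathfrak m\supset\mathfrak h$ be the Levi factor of $\mathfrak q$ containing $\mathfrak h$ (so that $\mathfrak q=\mathfrak m\oplus\mathfrak n$ as vector spaces), and let $\mathfrak t$ be the center of $\mathfrak m$. For $\nu\in\mathfrak t^*$ put $\mathfrak g_\nu=\{z\in\mathfrak g: [x,z]=\nu(x)z\ \ \forall x\in\mathfrak t\}$, and let $R=\{\nu\in\mathfrak t^*\setminus\{0\}:\mathfrak g_\nu\neq 0\}$ be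 the set of $\mathfrak t$-roots. Let $\alpha_1,\dots,\alpha_{\ell(\mathfrak t)}$ be the elements $\alpha\in\Pi$ with $e_\alpha\notin\mathfrak m$ (their number is $\ell(\mathfrak t)=\dim\mathfrak t$), and let $\beta_j=\alpha_j|_{\mathfrak t}$ (the simple $\mathfrak t$-roots). For $\nu\in R$ define its height $o(\nu)=\sum_{j=1}^{\ell(\mathfrak t)}n_{\alpha_j}(\varphi)$, where $\varphi\in\Delta$ is any root with $e_\varphi\in\mathfrak g_\nu$ (the value does not depend on $\varphi$, and $\nu=\sum_j n_{\alpha_j}(\varphi)\,\beta_j$). For an integer $k\ge 0$ put $\mathfrak n(k)=\sum_{\nu\in R,\ o(\nu)=k}\mathfrak g_\nu$, and let $$k(\mathrm{cent})=\sum_{i=1}^{\ell(\mathfrak t)}n_{\alpha_i}(\psi).$$ For subspaces $U,V\subset\mathfrak g$, $[U,V]$ denotes the linear span of the brackets $[u,v]$, $u\in U$, $v\in V$. The lower central series of $\mathfrak n$ is $\mathfrak n^1=\mathfrak n$, $\mathfrak n^i=[\mathfrak n,\mathfrak n^{i-1}]$ for $i\geq 2$, and its length is the largest $i$ with $\mathfrak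 n^i\ne0$. The upper central series is $\mathfrak n_0=0$, $\mathfrak n_i/\mathfrak n_{i-1}=\operatorname{cent}(\mathfrak n/\mathfrak n_{i-1})$ for $i\ge1$, and its length is the smallest $d$ with $\mathfrak n_d=\mathfrak n$. **Theorem.** 1. Let $2\le i\le k(\mathrm{cent})$ and let $\nu\in R$ with $\mathfrak g_\nu\subset\mathfrak n(i)$. Then there are $j\in\{1,\dots,\ell(\mathfrak t)\}$ and $\mu\in R$ with $\mathfrak g_\mu\subset\mathfrak n(i-1)$ such that $[\mathfrak g_{\beta_j},\mathfrak g_\mu]=\mathfrak g_\nu$. 2. $[\mathfrak n(1),\mathfrak n(i-1)]=\mathfrak n(i)$ for $2\le i\le k(\mathrm{cent})$. 3. $\mathfrak n^i=\sum_{j=i}^{k(\mathrm{cent})}\mathfrak n(j)$ for every $i\ge1$. 4. $k(\mathrm{cent})$ is the length of the lower central series of $\mathfrak n$, and also the length of the upper central series of $\mathfrak n$. 5. Except for indexing, the two series coincide: $\mathfrak n^i=\mathfrak n_{k(\mathrm{cent})-i+1}$ for $i=1,\dots,k(\mathrm{cent})$. -/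

import Mathlib

open LieAlgebra LieAlgebra.IsKilling Module

noncomputable section

namespace LeviRoots

/-- The nilradical of a Lie algebra: the sum of all ideals which are nilpotent as Lie algebras.
(This is not `LieAlgebra.maxNilpotentIdeal`, which asks that the whole algebra act nilpotently
on the ideal.) -/
def nilradical (L : Type*) [LieRing L] [LieAlgebra ℂ L] : LieIdeal ℂ L :=
  sSup {I : LieIdeal ℂ L | LieRing.IsNilpotent I}

section General

variable {𝔤 : Type*} [LieRing 𝔤] [LieAlgebra ℂ 𝔤]

/-- The nilradical of a subalgebra `𝔮` of `𝔤`, viewed as a subalgebra of `𝔤`. -/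
def nil (𝔮 : LieSubalgebra ℂ 𝔤) : LieSubalgebra ℂ 𝔤 :=
  ((nilradical 𝔮).toLieSubalgebra ℂ 𝔮).map 𝔮.incl

/-- `[U, V]`: the linear span of the brackets `[x, y]` with `x ∈ U`, `y ∈ V`. -/
def bracket (U V : Submodule ℂ 𝔤) : Submodule ℂ 𝔤 :=
  Submodule.span ℂ {z | ∃ x ∈ U, ∃ y ∈ V, ⁅x, y⁆ = z}

/-- `𝔮 = 𝔪 ⊕ 𝔫` as vector spaces, where `𝔫` is the nilradical of `𝔮`. For a parabolic
subalgebra `𝔮` of a semisimple Lie algebra, the subalgebras `𝔪` with this property are the Levi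
factors of `𝔮` (being isomorphic to `𝔮 / 𝔫`, they are reductive), and exactly one of them
contains a given Cartan subalgebra of `𝔤` lying in `𝔮`. -/
structure IsLeviFactor (𝔮 𝔪 : LieSubalgebra ℂ 𝔤) : Prop where
  sup_eq : 𝔪.toSubmodule ⊔ (nil 𝔮).toSubmodule = 𝔮.toSubmodule
  disjoint : Disjoint 𝔪.toSubmodule (nil 𝔮).toSubmodule

/-- The center `𝔱` of `𝔪`. -/
abbrev cent (𝔪 : LieSubalgebra ℂ 𝔤) : LieIdeal ℂ 𝔪 := LieAlgebra.center ℂ 𝔪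

/-- `𝔤_ν = {z ∈ 𝔤 | [x, z] = ν(x) z for all x ∈ 𝔱}`, for `ν ∈ 𝔱*`. -/
def tSpace (𝔪 : LieSubalgebra ℂ 𝔤) (ν : Dual ℂ (cent 𝔪)) : Submodule ℂ 𝔤 where
  carrier := {z | ∀ x : cent 𝔪, ⁅((x : 𝔪) : 𝔤), z⁆ = ν x • z}
  zero_mem' := by intro x; simp
  add_mem' := by
    intro a b ha hb x
    rw [lie_add, ha x, hb x, smul_add]
  smul_mem' := by
    intro c a ha x
    rw [lie_smul, ha x, smul_comm]

/-- `ν` is a `𝔱`-root: it is nonzero and `𝔤_ν ≠ 0`. -/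
def IsTRoot (𝔪 : LieSubalgebra ℂ 𝔤) (ν : Dual ℂ (cent 𝔪)) : Prop :=
  ν ≠ 0 ∧ tSpace 𝔪 ν ≠ ⊥

/-- The lower central series `𝔫^1 = 𝔫`, `𝔫^i = [𝔫, 𝔫^{i-1}]` of a Lie algebra `𝔫`, numbered
from `1` (Mathlib numbers it from `0`). -/
def lowerSeries (L : Type*) [LieRing L] [LieAlgebra ℂ L] (i : ℕ) : LieIdeal ℂ L :=
  LieModule.lowerCentralSeries ℂ L L (i - 1)

/-- The upper central series `𝔫_0 = 0`, `𝔫_i / 𝔫_{i-1} = cent (𝔫 / 𝔫_{i-1})`; in particular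
`𝔫_1 = cent 𝔫`. -/
def upperSeries (L : Type*) [LieRing L] [LieAlgebra ℂ L] (i : ℕ) : LieIdeal ℂ L :=
  (⊥ : LieSubmodule ℂ L L).ucs i

/-- The center of a subalgebra containing the Cartan subalgebra `H` lies in `H`. -/
theorem center_mem_cartan {H 𝔪 : LieSubalgebra ℂ 𝔤} [H.IsCartanSubalgebra] (hH : H ≤ 𝔪)
    (x : cent 𝔪) : ((x : 𝔪) : 𝔤) ∈ H := by
  rw [← LieSubalgebra.IsCartanSubalgebra.self_normalizing (H := H),
    LieSubalgebra.mem_normalizer_iff]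
  intro y hy
  have h := (LieModule.mem_maxTrivSubmodule (R := ℂ) (L := 𝔪) (M := 𝔪) (x : 𝔪)).1 x.2 ⟨y, hH hy⟩
  have h' : ⁅y, ((x : 𝔪) : 𝔤)⁆ = 0 := by
    simpa using congrArg (fun z : 𝔪 => (z : 𝔤)) h
  rw [← lie_skew, h', neg_zero]
  exact H.zero_mem

/-- The inclusion `𝔱 → 𝔥`. -/
def centIncl {H 𝔪 : LieSubalgebra ℂ 𝔤} [H.IsCartanSubalgebra] (hH : H ≤ 𝔪) :
    cent 𝔪 →ₗ[ℂ] H where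
  toFun x := ⟨((x : 𝔪) : 𝔤), center_mem_cartan hH x⟩
  map_add' _ _ := rfl
  map_smul' _ _ := rfl

/-- The restriction `γ ↦ γ_𝔱` from `𝔥*` to `𝔱*`. -/
def restrict {H 𝔪 : LieSubalgebra ℂ 𝔤} [H.IsCartanSubalgebra] (hH : H ≤ 𝔪) :
    Dual ℂ H →ₗ[ℂ] Dual ℂ (cent 𝔪) :=
  (centIncl hH).dualMap

end General

section Simple

variable {𝔤 : Type*} [LieRing 𝔤] [LieAlgebra ℂ 𝔤] [FiniteDimensional ℂ 𝔤]
  [LieAlgebra.IsSimple ℂ 𝔤] {H : LieSubalgebra ℂ 𝔤} [H.IsCartanSubalgebra]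

/-- The root space `ℂ e_φ` of a root `φ`. -/
def rootLine (φ : H.root) : Submodule ℂ 𝔤 :=
  (rootSpace H (φ : LieModule.Weight ℂ H 𝔤)).toSubmodule

/-- The Borel subalgebra `𝔟 = 𝔥 + ∑_{φ > 0} ℂ e_φ` (as a subspace) of a set of simple roots. -/
def borel (b : (rootSystem H).Base) : Submodule ℂ 𝔤 :=
  H.toSubmodule ⊔ ⨆ φ : H.root, ⨆ _ : b.IsPos φ, rootLine φ

/-- The integer `n_α(φ)` in the expansion `φ = ∑_{α ∈ Π} n_α(φ) α`. -/
def coeff (b : (rootSystem H).Base) (φ : H.root) (α : b.support) : ℤ :=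
  b.toWeightBasisInt.repr ((rootSystem H).rootSpanMem ℤ φ) α

/-- `ψ` is the highest root: it is maximal for the order in which `ψ ≤ φ` means that `φ - ψ` is a
sum of simple roots. -/
def IsHighestRoot (b : (rootSystem H).Base) (ψ : H.root) : Prop :=
  ∀ φ : H.root, (rootSystem H).root φ - (rootSystem H).root ψ ∈
    AddSubmonoid.closure ((rootSystem H).root '' (b.support : Set H.root)) → φ = ψ

open Classical in
/-- The simple roots `α_1, …, α_{ℓ(𝔱)}` which are not roots of `𝔪`. -/
def outerSimple (b : (rootSystem H).Base) (𝔪 : LieSubalgebra ℂ 𝔤) : Finset b.support :=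
  Finset.univ.filter fun α => ¬ rootLine (α : H.root) ≤ 𝔪.toSubmodule

open Classical in
/-- The integer `n_α(ν) = n_α(φ)`, where `φ` is any root with `e_φ ∈ 𝔤_ν`. For `α` among
`outerSimple b 𝔪` and a `𝔱`-root `ν`, such a `φ` exists and the value does not depend on it. -/
def tCoeff (b : (rootSystem H).Base) (𝔪 : LieSubalgebra ℂ 𝔤) (ν : Dual ℂ (cent 𝔪))
    (α : b.support) : ℤ :=
  if h : ∃ φ : H.root, rootLine φ ≤ tSpace 𝔪 ν then coeff b h.choose α else 0

/-- The height `o(ν) = ∑_j n_{α_j}(ν)` of a `𝔱`-root. -/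
def tHeight (b : (rootSystem H).Base) (𝔪 : LieSubalgebra ℂ 𝔤) (ν : Dual ℂ (cent 𝔪)) : ℤ :=
  ∑ α ∈ outerSimple b 𝔪, tCoeff b 𝔪 ν α

/-- `𝔫(k) = ∑ 𝔤_ν` over the `𝔱`-roots `ν` with `o(ν) = k`. -/
def graded (b : (rootSystem H).Base) (𝔪 : LieSubalgebra ℂ 𝔤) (k : ℕ) : Submodule ℂ 𝔤 :=
  ⨆ ν : Dual ℂ (cent 𝔪), ⨆ _ : IsTRoot 𝔪 ν, ⨆ _ : tHeight b 𝔪 ν = (k : ℤ), tSpace 𝔪 ν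

/-- `β_α = α_𝔱`, the restriction to `𝔱` of a simple root `α`. -/
def simpleTRoot (b : (rootSystem H).Base) {𝔪 : LieSubalgebra ℂ 𝔤} (hH : H ≤ 𝔪)
    (α : b.support) : Dual ℂ (cent 𝔪) :=
  restrict hH ((rootSystem H).root α)

end Simple

end LeviRoots

end

/-! Let the partial height of a root be the sum of its coefficients at the set `J` of simple roots
outside 𝔪. Everything in sight is a sum of root spaces cut out by these coefficients: 𝔮 and 𝔪 are 𝔥
plus the root spaces of partial height ≥ 0 and = 0 respectively, 𝔫 is the sum of those of partial
height ≥ 1, and each 𝔤_ν with ν a 𝔱-root is the sum over one class of roots sharing their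
coefficients at `J`. Since [𝔤_φ, 𝔤_ψ] = 𝔤_{φ+ψ} whenever φ + ψ is a root, brackets become sums of
roots (`bracket_rootSum`), and the theorem becomes combinatorics of roots.

The engine is the irreducibility of 𝔤_ν as an 𝔪-module, in the form `mem_of_forall_levi_add_mem`: a
nonempty part of a class that is closed under adding roots of 𝔪 is the whole class. This is proved
with the positive definite form on the root lattice, without highest weight theory. It is combined
with `exists_root_eq_add_of_root_add_add`, a combinatorial shadow of the Jacobi identity, which
shows that the relevant properties of a root survive the addition of a root of 𝔪. Hence one well
chosen member of each class suffices.

Going down: in a class of partial height ≥ 2, the member of least total height is a root plus a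
simple root in `J`. So the whole class splits (`exists_forall_root_eq_add`), which gives the first
two claims and identifies 𝔫^i with partial height ≥ i.

Going up: if no root of partial height one can be added to a member of a class, then no simple root
can be added to the member of greatest total height, which must be the highest root. So every root
of 𝔫 of partial height below k(cent) can be raised by one (`exists_partialHeight_eq_one_root_add`),
and 𝔫_d consists of the partial heights ≥ k(cent) + 1 - d. Comparing thresholds gives the remaining
claims. -/

noncomputable section

/-! ### The positive definite form on the root lattice. -/

namespace RootPairing

section Lattice

variable {ι R M N : Type*} [CommRing R] [AddCommGroup M] [Module R M]
  [AddCommGroup N] [Module R N] {P : RootPairing ι R M N}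

lemma rootSpanMem_add {i j k : ι} (hk : P.root k = P.root i + P.root j) :
    P.rootSpanMem ℤ k = P.rootSpanMem ℤ i + P.rootSpanMem ℤ j :=
  Subtype.ext hk

lemma rootSpanMem_neg {i k : ι} (hk : P.root k = -P.root i) :
    P.rootSpanMem ℤ k = -P.rootSpanMem ℤ i :=
  Subtype.ext hk

lemma rootSpanMem_ne_zero [NeZero (2 : R)] (i : ι) : P.rootSpanMem ℤ i ≠ 0 :=
  fun h ↦ P.ne_zero i (congrArg Subtype.val h)

variable (P) in
lemma exists_root_eq_neg (i : ι) : ∃ k, P.root k = -P.root i :=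
  ⟨P.reflectionPerm i i, by simp⟩

end Lattice

section Form

variable {ι R M N : Type*} [Fintype ι] [Field R] [CharZero R] [AddCommGroup M] [Module R M]
  [AddCommGroup N] [Module R N] (P : RootPairing ι R M N) [P.IsCrystallographic]

/-- The canonical integral positive definite form on the root lattice. -/
def latticeForm : LinearMap.BilinForm ℤ (P.rootSpan ℤ) :=
  (P.posRootForm ℤ).posForm

lemma latticeForm_comm (x y : P.rootSpan ℤ) : P.latticeForm x y = P.latticeForm y x :=
  (P.posRootForm ℤ).isSymm_posForm.eq x y

lemma latticeForm_self_pos {x : P.rootSpan ℤ} (hx : x ≠ 0) : 0 < P.latticeForm x x :=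
  P.posRootForm_posForm_pos_of_ne_zero ℤ hx

lemma latticeForm_root_pos_iff (i j : ι) :
    0 < P.latticeForm (P.rootSpanMem ℤ i) (P.rootSpanMem ℤ j) ↔ 0 < P.pairingIn ℤ i j :=
  (P.posRootForm ℤ).zero_lt_apply_root_root_iff i j

/-- Lets orthogonality be read off from Cartan integers and conversely. -/
lemma two_mul_latticeForm_root (i j : ι) :
    2 * P.latticeForm (P.rootSpanMem ℤ i) (P.rootSpanMem ℤ j) =
      P.pairingIn ℤ i j * P.latticeForm (P.rootSpanMem ℤ j) (P.rootSpanMem ℤ j) := by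
  apply FaithfulSMul.algebraMap_injective ℤ R
  rw [map_mul, map_mul, map_ofNat, latticeForm, RootPositiveForm.algebraMap_posForm,
    RootPositiveForm.algebraMap_posForm, algebraMap_pairingIn]
  exact (P.posRootForm ℤ).two_mul_apply_root_root i j

variable {P}

lemma exists_root_eq_sub_of_latticeForm_pos {i j : ι}
    (h : 0 < P.latticeForm (P.rootSpanMem ℤ i) (P.rootSpanMem ℤ j)) (hij : i ≠ j) :
    ∃ k, P.root k = P.root i - P.root j :=
  P.root_sub_root_mem_of_pairingIn_pos ((P.latticeForm_root_pos_iff i j).1 h) hij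

lemma exists_root_eq_add_of_latticeForm_neg {i j : ι}
    (h : P.latticeForm (P.rootSpanMem ℤ i) (P.rootSpanMem ℤ j) < 0)
    (hij : P.root i ≠ -P.root j) :
    ∃ k, P.root k = P.root i + P.root j := by
  obtain ⟨j', hj'⟩ := P.exists_root_eq_neg j
  obtain ⟨k, hk⟩ := exists_root_eq_sub_of_latticeForm_pos (P := P) (i := i) (j := j')
    (by rw [rootSpanMem_neg hj', map_neg]; linarith) (by rintro rfl; exact hij hj')
  exact ⟨k, by rw [hk, hj', sub_neg_eq_add]⟩

/-- If `x + y` and `x + y + z` are roots, then one of `x + z`, `y + z` is a root or zero. -/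
lemma exists_root_eq_add_of_root_add_add {x y z u w : ι} (hu : P.root u = P.root x + P.root y)
    (hw : P.root w = P.root u + P.root z) (hxz : P.root x ≠ -P.root z)
    (hyz : P.root y ≠ -P.root z) :
    (∃ k, P.root k = P.root x + P.root z) ∨ ∃ k, P.root k = P.root y + P.root z := by
  by_contra! hcon
  obtain ⟨hx, hy⟩ := hcon
  have hxz0 : 0 ≤ P.latticeForm (P.rootSpanMem ℤ x) (P.rootSpanMem ℤ z) := by
    by_contra! h
    obtain ⟨k, hk⟩ := exists_root_eq_add_of_latticeForm_neg h hxz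
    exact hx k hk
  have hyz0 : 0 ≤ P.latticeForm (P.rootSpanMem ℤ y) (P.rootSpanMem ℤ z) := by
    by_contra! h
    obtain ⟨k, hk⟩ := exists_root_eq_add_of_latticeForm_neg h hyz
    exact hy k hk
  have hwx : P.latticeForm (P.rootSpanMem ℤ w) (P.rootSpanMem ℤ x) ≤ 0 := by
    by_contra! h
    obtain ⟨k, hk⟩ := exists_root_eq_sub_of_latticeForm_pos h (by
      rintro rfl
      exact hyz (by rw [hu, add_assoc, left_eq_add] at hw; exact eq_neg_of_add_eq_zero_left hw))
    exact hy k (by rw [hk, hw, hu]; abel)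
  have hwy : P.latticeForm (P.rootSpanMem ℤ w) (P.rootSpanMem ℤ y) ≤ 0 := by
    by_contra! h
    obtain ⟨k, hk⟩ := exists_root_eq_sub_of_latticeForm_pos h (by
      rintro rfl
      refine hxz (eq_neg_of_add_eq_zero_left ?_)
      have : P.root w = (P.root x + P.root z) + P.root w := by rw [← add_right_comm, ← hu, ← hw]
      simpa using this)
    exact hx k (by rw [hk, hw, hu]; abel)
  -- Neither w - x = y + z nor w - y = x + z is a root, so (w, u) = (w, x) + (w, y) ≤ 0. But also
  -- (w, u) = (u, u) + (x, z) + (y, z) > 0.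
  have hself := P.latticeForm_self_pos (rootSpanMem_ne_zero u)
  have e1 : P.latticeForm (P.rootSpanMem ℤ w) (P.rootSpanMem ℤ u) =
      P.latticeForm (P.rootSpanMem ℤ w) (P.rootSpanMem ℤ x) +
        P.latticeForm (P.rootSpanMem ℤ w) (P.rootSpanMem ℤ y) := by
    rw [rootSpanMem_add hu, map_add]
  have e2 : P.latticeForm (P.rootSpanMem ℤ w) (P.rootSpanMem ℤ u) =
      P.latticeForm (P.rootSpanMem ℤ u) (P.rootSpanMem ℤ u) +
        P.latticeForm (P.rootSpanMem ℤ u) (P.rootSpanMem ℤ z) := by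
    rw [rootSpanMem_add hw, map_add, LinearMap.add_apply,
      P.latticeForm_comm (P.rootSpanMem ℤ z)]
  have e3 : P.latticeForm (P.rootSpanMem ℤ u) (P.rootSpanMem ℤ z) =
      P.latticeForm (P.rootSpanMem ℤ x) (P.rootSpanMem ℤ z) +
        P.latticeForm (P.rootSpanMem ℤ y) (P.rootSpanMem ℤ z) := by
    rw [rootSpanMem_add hu, map_add, LinearMap.add_apply]
  linarith

end Form

/-! ### Coefficients at simple roots and partial heights. -/

namespace Base

variable {ι R M N : Type*} [Field R] [CharZero R] [AddCommGroup M] [Module R M]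
  [AddCommGroup N] [Module R N] {P : RootPairing ι R M N}
  (b : P.Base)

lemma toWeightBasisInt_eq (β : b.support) :
    b.toWeightBasisInt β = P.rootSpanMem ℤ (β : ι) :=
  Subtype.ext (b.coe_toWeightBasisInt_apply β)

/-- The coefficient of a root at a simple root. -/
def rootCoeff (i : ι) (α : b.support) : ℤ :=
  b.toWeightBasisInt.repr (P.rootSpanMem ℤ i) α

lemma sum_rootCoeff_smul (i : ι) :
    ∑ α, b.rootCoeff i α • P.rootSpanMem ℤ (α : ι) = P.rootSpanMem ℤ i := by
  have := b.toWeightBasisInt.sum_repr (P.rootSpanMem ℤ i)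
  simpa only [toWeightBasisInt_eq, rootCoeff] using this

lemma rootCoeff_add {i j k : ι} (hk : P.root k = P.root i + P.root j) (α : b.support) :
    b.rootCoeff k α = b.rootCoeff i α + b.rootCoeff j α := by
  have : P.rootSpanMem ℤ k = P.rootSpanMem ℤ i + P.rootSpanMem ℤ j := Subtype.ext hk
  rw [rootCoeff, this, map_add]; rfl

lemma rootCoeff_neg {i k : ι} (hk : P.root k = -P.root i) (α : b.support) :
    b.rootCoeff k α = -b.rootCoeff i α := by
  have : P.rootSpanMem ℤ k = -P.rootSpanMem ℤ i := Subtype.ext hk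
  rw [rootCoeff, this, map_neg]; rfl

lemma rootCoeff_sub {i j k : ι} (hk : P.root k = P.root i - P.root j) (α : b.support) :
    b.rootCoeff k α = b.rootCoeff i α - b.rootCoeff j α := by
  have := b.rootCoeff_add (i := k) (j := j) (k := i) (by rw [hk]; abel) α
  linarith

open Classical in
lemma rootCoeff_simple (β α : b.support) : b.rootCoeff β α = if β = α then 1 else 0 := by
  rw [rootCoeff, ← toWeightBasisInt_eq, Basis.repr_self, Finsupp.single_apply]

lemma rootCoeff_simple_nonneg (β α : b.support) : 0 ≤ b.rootCoeff β α := by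
  classical
  rw [rootCoeff_simple]; split_ifs <;> simp

lemma rootCoeff_simple_of_ne {β α : b.support} (h : β ≠ α) : b.rootCoeff β α = 0 := by
  classical
  rw [rootCoeff_simple, if_neg h]

lemma exists_rootCoeff_ne_zero (i : ι) : ∃ α, b.rootCoeff i α ≠ 0 := by
  by_contra! h
  apply P.ne_zero i
  have := b.sum_rootCoeff_smul i
  simp only [h, zero_smul, Finset.sum_const_zero] at this
  exact (congrArg Subtype.val this).symm

lemma isPos_or_isPos_of_root_eq_neg {i k : ι} (hk : P.root k = -P.root i) :
    b.IsPos i ∨ b.IsPos k := by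
  have : k = P.reflectionPerm i i := P.root.injective (by rw [hk]; simp)
  rw [this]
  exact IsPos.or_neg b i

lemma not_isPos_of_root_eq_neg {i k : ι} (hk : P.root k = -P.root i) (hi : b.IsPos i) :
    ¬ b.IsPos k := by
  have : k = P.reflectionPerm i i := P.root.injective (by rw [hk]; simp)
  rw [this]
  exact fun h ↦ (IsPos.neg_iff_not b i).1 h hi

/-- The contribution to the height of a root of the simple roots in `J`. -/
def partialHeight (J : Finset b.support) (i : ι) : ℤ := ∑ α ∈ J, b.rootCoeff i α

variable (J : Finset b.support)

lemma partialHeight_add {i j k : ι} (hk : P.root k = P.root i + P.root j) :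
    b.partialHeight J k = b.partialHeight J i + b.partialHeight J j := by
  simp only [partialHeight, b.rootCoeff_add hk, Finset.sum_add_distrib]

lemma partialHeight_neg {i k : ι} (hk : P.root k = -P.root i) :
    b.partialHeight J k = -b.partialHeight J i := by
  simp only [partialHeight, b.rootCoeff_neg hk, Finset.sum_neg_distrib]

lemma partialHeight_simple_of_mem {α : b.support} (hα : α ∈ J) : b.partialHeight J α = 1 := by
  classical
  simp [partialHeight, rootCoeff_simple, hα]

lemma partialHeight_simple_of_notMem {α : b.support} (hα : α ∉ J) :
    b.partialHeight J α = 0 := by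
  classical
  simp [partialHeight, rootCoeff_simple, hα]

variable [Fintype ι] [P.IsCrystallographic]

variable {b} in
lemma IsPos.rootCoeff_nonneg {i : ι} (hi : b.IsPos i) : ∀ α, 0 ≤ b.rootCoeff i α := by
  refine hi.induction_on_add (p := fun i ↦ ∀ α, 0 ≤ b.rootCoeff i α)
    (fun j hj α ↦ b.rootCoeff_simple_nonneg ⟨j, hj⟩ α) (fun j l k hk hj hl α ↦ ?_)
  rw [b.rootCoeff_add hk]
  exact add_nonneg (hj α) (b.rootCoeff_simple_nonneg ⟨l, hl⟩ α)

lemma isPos_of_rootCoeff_pos {i : ι} {α : b.support} (h : 0 < b.rootCoeff i α) : b.IsPos i := by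
  obtain ⟨k, hk⟩ := P.exists_root_eq_neg i
  refine (b.isPos_or_isPos_of_root_eq_neg hk).resolve_right fun h' ↦ ?_
  have := h'.rootCoeff_nonneg α
  rw [b.rootCoeff_neg hk] at this
  linarith

lemma rootCoeff_nonneg_or_nonpos (i : ι) :
    (∀ α, 0 ≤ b.rootCoeff i α) ∨ ∀ α, b.rootCoeff i α ≤ 0 := by
  obtain ⟨k, hk⟩ := P.exists_root_eq_neg i
  refine (b.isPos_or_isPos_of_root_eq_neg hk).imp (fun h ↦ h.rootCoeff_nonneg) fun h α ↦ ?_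
  have := h.rootCoeff_nonneg α
  rw [b.rootCoeff_neg hk] at this
  linarith

lemma isPos_of_partialHeight_pos {i : ι} (h : 0 < b.partialHeight J i) : b.IsPos i := by
  obtain ⟨α, -, hα⟩ := Finset.exists_lt_of_sum_lt (f := fun _ ↦ (0 : ℤ)) (by simpa [partialHeight] using h)
  exact b.isPos_of_rootCoeff_pos hα

variable {b} in
lemma IsPos.partialHeight_nonneg {i : ι} (hi : b.IsPos i) : 0 ≤ b.partialHeight J i :=
  Finset.sum_nonneg fun α _ ↦ hi.rootCoeff_nonneg α

/-- The coefficients of a root all have the same sign, so nothing cancels in the sum. These are the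
roots of the Levi factor. -/
lemma partialHeight_eq_zero_iff {i : ι} :
    b.partialHeight J i = 0 ↔ ∀ α ∈ J, b.rootCoeff i α = 0 := by
  rcases b.rootCoeff_nonneg_or_nonpos i with h | h
  · exact Finset.sum_eq_zero_iff_of_nonneg fun α _ ↦ h α
  · exact Finset.sum_eq_zero_iff_of_nonpos fun α _ ↦ h α

variable {b} in
lemma IsPos.partialHeight_univ_pos {i : ι} (hi : b.IsPos i) :
    0 < b.partialHeight Finset.univ i := by
  refine (hi.partialHeight_nonneg _).lt_of_ne' fun h ↦ ?_
  obtain ⟨α, hα⟩ := b.exists_rootCoeff_ne_zero i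
  exact hα ((b.partialHeight_eq_zero_iff _).1 h α (Finset.mem_univ α))

variable {b} in
/-- A positive root is simple, or a positive root plus a simple root having positive inner product
with it. -/
lemma IsPos.mem_support_or_exists_eq_add {i : ι} (hi : b.IsPos i) :
    ∃ α : b.support, 0 < P.latticeForm (P.rootSpanMem ℤ i) (P.rootSpanMem ℤ (α : ι)) ∧
      (i = α ∨ ∃ k, b.IsPos k ∧ P.root i = P.root k + P.root (α : ι)) := by
  obtain ⟨j, hj, hj'⟩ := hi.exists_mem_support_pos_pairingIn
  rw [P.zero_lt_pairingIn_iff', ← P.latticeForm_root_pos_iff] at hj'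
  refine ⟨⟨j, hj⟩, hj', ?_⟩
  rcases eq_or_ne i j with rfl | hij
  · exact .inl rfl
  · obtain ⟨k, hk⟩ := exists_root_eq_sub_of_latticeForm_pos hj' hij
    exact .inr ⟨k, hi.sub hj hk, by rw [hk]; abel⟩

end Base

end RootPairing

end

noncomputable section

namespace RootPairing.Base

variable {ι R M N : Type*} [Fintype ι] [Field R] [CharZero R] [AddCommGroup M] [Module R M]
  [AddCommGroup N] [Module R N] {P : RootPairing ι R M N}
  (b : P.Base) [P.IsCrystallographic]

/-! ### Classes of roots modulo the Levi factor. -/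

section Levi

variable [P.IsReduced] (J : Finset b.support)

/-- Root strings have no gaps, so the multiple of β can be added one step at a time without leaving
the set of roots. The nonzero coefficient of γ at `J` rules out γ = ±β. -/
lemma mem_of_root_eq_add_nsmul {A : Set ι}
    (hA : ∀ γ ∈ A, ∀ β δ, (∀ α ∈ J, b.rootCoeff β α = 0) →
      P.root δ = P.root γ + P.root β → δ ∈ A)
    {γ β : ι} (hγ : γ ∈ A) (hβ : ∀ α ∈ J, b.rootCoeff β α = 0)
    (hne : ∃ α ∈ J, b.rootCoeff γ α ≠ 0) (n : ℕ) {δ : ι}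
    (hδ : P.root δ = P.root γ + n • P.root β) : δ ∈ A := by
  obtain ⟨α, hα, hγα⟩ := hne
  have hli : LinearIndependent R ![P.root β, P.root γ] := by
    refine IsReduced.linearIndependent P (fun h ↦ hγα (h ▸ hβ α hα)) fun h ↦ hγα ?_
    have := b.rootCoeff_neg h α
    rw [hβ α hα] at this
    linarith
  induction n generalizing δ with
  | zero => rwa [P.root.injective (show P.root δ = P.root γ by simpa using hδ)]
  | succ n ih =>
    have hn : P.root γ + (n + 1) • P.root β ∈ Set.range P.root := ⟨δ, hδ⟩
    rw [P.root_add_nsmul_mem_range_iff_le_chainTopCoeff hli] at hn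
    obtain ⟨ε, hε⟩ := (P.root_add_nsmul_mem_range_iff_le_chainTopCoeff hli (n := n)).2 (by omega)
    exact hA ε (ih hε) β δ hβ (by rw [hδ, hε, succ_nsmul, add_assoc])

/-- The reflected root lies on the β-string through γ; according to the sign of the Cartan integer
it is reached by adding copies of -β or of β. -/
lemma reflectionPerm_mem_of_closed {A : Set ι}
    (hA : ∀ γ ∈ A, ∀ β δ, (∀ α ∈ J, b.rootCoeff β α = 0) →
      P.root δ = P.root γ + P.root β → δ ∈ A)
    {γ β : ι} (hγ : γ ∈ A) (hβ : ∀ α ∈ J, b.rootCoeff β α = 0)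
    (hne : ∃ α ∈ J, b.rootCoeff γ α ≠ 0) : P.reflectionPerm β γ ∈ A := by
  have h : P.root (P.reflectionPerm β γ) = P.root γ - P.pairingIn ℤ γ β • P.root β := by
    rw [root_reflectionPerm, reflection_apply_root' ℤ]
  rcases le_total 0 (P.pairingIn ℤ γ β) with h0 | h0
  · obtain ⟨n, hn⟩ := Int.eq_ofNat_of_zero_le h0
    obtain ⟨β', hβ'⟩ := P.exists_root_eq_neg β
    refine b.mem_of_root_eq_add_nsmul J hA hγ (β := β') (fun α hα ↦ ?_) hne n ?_
    · rw [b.rootCoeff_neg hβ', hβ α hα, neg_zero]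
    · rw [h, hn, hβ', natCast_zsmul, smul_neg, sub_eq_add_neg]
  · obtain ⟨n, hn⟩ := Int.eq_ofNat_of_zero_le (neg_nonneg.2 h0)
    refine b.mem_of_root_eq_add_nsmul J hA hγ hβ hne n ?_
    rw [h, ← neg_neg (P.pairingIn ℤ γ β), hn, neg_smul, natCast_zsmul, sub_neg_eq_add]

omit [Fintype ι] [P.IsReduced] in
lemma rootCoeff_reflectionPerm_of_levi {β : ι} (hβ : ∀ α ∈ J, b.rootCoeff β α = 0) (γ : ι)
    {α : b.support} (hα : α ∈ J) :
    b.rootCoeff (P.reflectionPerm β γ) α = b.rootCoeff γ α := by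
  have h : P.rootSpanMem ℤ (P.reflectionPerm β γ) =
      P.rootSpanMem ℤ γ - P.pairingIn ℤ γ β • P.rootSpanMem ℤ β :=
    Subtype.ext (by
      change P.root (P.reflectionPerm β γ) = P.root γ - P.pairingIn ℤ γ β • P.root β
      rw [root_reflectionPerm, reflection_apply_root' ℤ])
  have h0 : b.toWeightBasisInt.repr (P.rootSpanMem ℤ β) α = 0 := hβ α hα
  rw [rootCoeff, h, map_sub, map_smul, Finsupp.sub_apply, Finsupp.smul_apply, h0, smul_zero,
    sub_zero, rootCoeff]

omit [P.IsReduced] in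
/-- The sum of a set of roots stable under a reflection is orthogonal to the mirror root. -/
lemma latticeForm_sum_eq_zero_of_reflectionPerm_mem {s : Finset ι} {β : ι}
    (hs : ∀ γ ∈ s, P.reflectionPerm β γ ∈ s) :
    P.latticeForm (∑ γ ∈ s, P.rootSpanMem ℤ γ) (P.rootSpanMem ℤ β) = 0 := by
  have hsum : ∑ γ ∈ s, P.pairingIn ℤ γ β = 0 := by
    have h : ∑ γ ∈ s, P.pairingIn ℤ γ β = ∑ γ ∈ s, -P.pairingIn ℤ γ β :=
      Finset.sum_bij' (fun γ _ ↦ P.reflectionPerm β γ) (fun γ _ ↦ P.reflectionPerm β γ)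
        hs hs (by simp) (by simp) (fun γ _ ↦ by
          rw [← pairingIn_reflectionPerm, P.pairingIn_reflectionPerm_self_right, neg_neg])
    rw [Finset.sum_neg_distrib] at h
    linarith
  have h2 : 2 * P.latticeForm (∑ γ ∈ s, P.rootSpanMem ℤ γ) (P.rootSpanMem ℤ β) = 0 := by
    rw [map_sum, LinearMap.sum_apply, Finset.mul_sum]
    simp_rw [P.two_mul_latticeForm_root, ← Finset.sum_mul, hsum, zero_mul]
  linarith

/-- A nonempty set of roots with prescribed coefficients, not all zero, at the simple roots in `J`
which is closed under adding roots of the Levi factor contains all roots with these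
coefficients. This is the irreducibility of the root spaces of the center of the Levi factor. -/
theorem mem_of_forall_levi_add_mem {A : Set ι}
    (hA : ∀ γ ∈ A, ∀ β δ, (∀ α ∈ J, b.rootCoeff β α = 0) →
      P.root δ = P.root γ + P.root β → δ ∈ A)
    {γ δ : ι} (hγ : γ ∈ A) (hγδ : ∀ α ∈ J, b.rootCoeff δ α = b.rootCoeff γ α)
    (hne : ∃ α ∈ J, b.rootCoeff γ α ≠ 0) : δ ∈ A := by
  classical
  by_contra hδ
  let F : Finset ι := Finset.univ.filter fun χ ↦ ∀ α ∈ J, b.rootCoeff χ α = b.rootCoeff γ α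
  let s := F.filter (· ∈ A)
  let t := F.filter (· ∉ A)
  have hF {χ : ι} : χ ∈ F ↔ ∀ α ∈ J, b.rootCoeff χ α = b.rootCoeff γ α := by simp [F]
  have hsA {χ : ι} : χ ∈ s ↔ χ ∈ F ∧ χ ∈ A := Finset.mem_filter
  have htA {χ : ι} : χ ∈ t ↔ χ ∈ F ∧ χ ∉ A := Finset.mem_filter
  have hγs : γ ∈ s := hsA.2 ⟨hF.2 fun _ _ ↦ rfl, hγ⟩
  have hδt : δ ∈ t := htA.2 ⟨hF.2 hγδ, hδ⟩
  have hFne {χ : ι} (hχ : χ ∈ F) : ∃ α ∈ J, b.rootCoeff χ α ≠ 0 := by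
    obtain ⟨α, hα, h⟩ := hne
    exact ⟨α, hα, by rwa [hF.1 hχ α hα]⟩
  have hFr {β χ : ι} (hβ : ∀ α ∈ J, b.rootCoeff β α = 0) (hχ : χ ∈ F) :
      P.reflectionPerm β χ ∈ F :=
    hF.2 fun α hα ↦ (b.rootCoeff_reflectionPerm_of_levi J hβ χ hα).trans (hF.1 hχ α hα)
  have hsr {β : ι} (hβ : ∀ α ∈ J, b.rootCoeff β α = 0) (χ : ι) (hχ : χ ∈ s) :
      P.reflectionPerm β χ ∈ s :=
    hsA.2 ⟨hFr hβ (hsA.1 hχ).1,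
      b.reflectionPerm_mem_of_closed J hA (hsA.1 hχ).2 hβ (hFne (hsA.1 hχ).1)⟩
  have htr {β : ι} (hβ : ∀ α ∈ J, b.rootCoeff β α = 0) (χ : ι) (hχ : χ ∈ t) :
      P.reflectionPerm β χ ∈ t := by
    refine htA.2 ⟨hFr hβ (htA.1 hχ).1, fun h ↦ (htA.1 hχ).2 ?_⟩
    simpa using b.reflectionPerm_mem_of_closed J hA h hβ (hFne (hFr hβ (htA.1 hχ).1))
  set σ := ∑ χ ∈ s, P.rootSpanMem ℤ χ with hσ
  set τ := ∑ χ ∈ t, P.rootSpanMem ℤ χ with hτ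
  have hrepr {u : Finset ι} (hu : u ⊆ F) {α : b.support} (hα : α ∈ J) :
      b.toWeightBasisInt.repr (∑ χ ∈ u, P.rootSpanMem ℤ χ) α = u.card * b.rootCoeff γ α := by
    rw [map_sum, Finsupp.finsetSum_apply, Finset.sum_congr rfl (fun χ hχ ↦
      show b.toWeightBasisInt.repr (P.rootSpanMem ℤ χ) α = b.rootCoeff γ α from
        hF.1 (hu hχ) α hα)]
    simp
  have hsF : s ⊆ F := Finset.filter_subset _ _
  have htF : t ⊆ F := Finset.filter_subset _ _
  -- The difference has zero coefficients at `J`, so it is a combination of simple roots of the Levi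
  -- factor. Both σ and τ are orthogonal to these, by stability of `s` and `t` under their
  -- reflections. Hence the difference is orthogonal to itself.
  have hx : (t.card : ℤ) • σ = (s.card : ℤ) • τ := by
    rw [← sub_eq_zero]
    by_contra hx
    refine (P.latticeForm_self_pos hx).ne' ?_
    set x := (t.card : ℤ) • σ - (s.card : ℤ) • τ with hxdef
    have horth {α : b.support} (hα : α ∉ J) : P.latticeForm x (P.rootSpanMem ℤ (α : ι)) = 0 := by
      have hl : ∀ α' ∈ J, b.rootCoeff α α' = 0 := fun α' hα' ↦
        b.rootCoeff_simple_of_ne fun h ↦ hα (h ▸ hα')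
      rw [hxdef, map_sub, map_smul, map_smul, LinearMap.sub_apply, LinearMap.smul_apply,
        LinearMap.smul_apply, hσ, hτ, latticeForm_sum_eq_zero_of_reflectionPerm_mem (hsr hl),
        latticeForm_sum_eq_zero_of_reflectionPerm_mem (htr hl), smul_zero, smul_zero, sub_zero]
    rw [← congrArg (P.latticeForm x) (b.toWeightBasisInt.sum_repr x), map_sum]
    refine Finset.sum_eq_zero fun α _ ↦ ?_
    rw [map_smul, toWeightBasisInt_eq]
    by_cases hα : α ∈ J
    · have : b.toWeightBasisInt.repr x α = 0 := by
        rw [hxdef, map_sub, map_smul, map_smul, Finsupp.sub_apply, Finsupp.smul_apply,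
          Finsupp.smul_apply, hσ, hτ, hrepr hsF hα, hrepr htF hα, smul_eq_mul, smul_eq_mul]
        ring
      rw [this, zero_smul]
    · rw [horth hα, smul_zero]
  -- A positive product of χ in `s` and η in `t` would make η - χ a root of the Levi factor, and
  -- closedness would put η in `A`.
  have hle : P.latticeForm σ τ ≤ 0 := by
    rw [hσ, hτ, map_sum]
    refine Finset.sum_nonpos fun η hη ↦ ?_
    rw [map_sum, LinearMap.sum_apply]
    refine Finset.sum_nonpos fun χ hχ ↦ ?_
    by_contra! h
    obtain ⟨β, hβ⟩ := exists_root_eq_sub_of_latticeForm_pos (by rwa [P.latticeForm_comm] at h)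
      (by rintro rfl; exact (htA.1 hη).2 (hsA.1 hχ).2)
    refine (htA.1 hη).2 (hA χ (hsA.1 hχ).2 β η (fun α hα ↦ ?_) (by rw [hβ]; abel))
    rw [b.rootCoeff_sub hβ, hF.1 (htA.1 hη).1 α hα, hF.1 (hsA.1 hχ).1 α hα, sub_self]
  have hσ0 : σ ≠ 0 := by
    intro h
    obtain ⟨α, hα, hγα⟩ := hne
    have := hrepr hsF hα
    rw [← hσ, h, map_zero, Finsupp.zero_apply, eq_comm, mul_eq_zero] at this
    rcases this with h' | h'
    · exact Finset.card_ne_zero_of_mem hγs (by exact_mod_cast h')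
    · exact hγα h'
  have hspos : (0 : ℤ) < s.card := by exact_mod_cast Finset.card_pos.2 ⟨γ, hγs⟩
  have htpos : (0 : ℤ) < t.card := by exact_mod_cast Finset.card_pos.2 ⟨δ, hδt⟩
  -- σ and τ are nonzero and positively proportional, so their product is positive, against `hle`.
  have h1 : (t.card : ℤ) * P.latticeForm σ σ = s.card * P.latticeForm σ τ := by
    rw [← smul_eq_mul, ← smul_eq_mul, ← map_smul, ← map_smul, hx]
  have h2 := mul_pos htpos (P.latticeForm_self_pos hσ0)
  nlinarith

omit [P.IsReduced] in
/-- A root of partial height at least two has the same coefficients at `J` as the sum of a root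
and of a simple root in `J`. -/
lemma exists_root_eq_add_of_two_le_partialHeight {γ : ι} (hγ : 2 ≤ b.partialHeight J γ) :
    ∃ δ μ, ∃ α ∈ J, (∀ α ∈ J, b.rootCoeff δ α = b.rootCoeff γ α) ∧
      P.root δ = P.root μ + P.root (α : ι) := by
  classical
  let F : Finset ι := Finset.univ.filter fun χ ↦ ∀ α ∈ J, b.rootCoeff χ α = b.rootCoeff γ α
  have hF {χ : ι} : χ ∈ F ↔ ∀ α ∈ J, b.rootCoeff χ α = b.rootCoeff γ α := by simp [F]
  -- With δ of least total height in the class, a simple root that can be subtracted from δ must be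
  -- in `J`: subtracting any other would stay in the class and lower the height.
  obtain ⟨δ, hδF, hmin⟩ := F.exists_min_image (b.partialHeight Finset.univ)
    ⟨γ, hF.2 fun _ _ ↦ rfl⟩
  have hδ2 : 2 ≤ b.partialHeight J δ := by
    rwa [partialHeight, Finset.sum_congr rfl (hF.1 hδF)]
  have hδ : b.IsPos δ := b.isPos_of_partialHeight_pos J (by linarith)
  obtain ⟨α, -, rfl | ⟨μ, -, hμ⟩⟩ := hδ.mem_support_or_exists_eq_add
  · by_cases hα : α ∈ J
    · rw [b.partialHeight_simple_of_mem J hα] at hδ2; omega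
    · rw [b.partialHeight_simple_of_notMem J hα] at hδ2; omega
  · refine ⟨δ, μ, α, ?_, hF.1 hδF, hμ⟩
    by_contra hα
    have hμF : μ ∈ F := hF.2 fun α' hα' ↦ by
      rw [← hF.1 hδF α' hα', b.rootCoeff_add hμ,
        b.rootCoeff_simple_of_ne (β := α) (fun h ↦ hα (h ▸ hα')), add_zero]
    have := hmin μ hμF
    rw [b.partialHeight_add _ hμ, b.partialHeight_simple_of_mem _ (Finset.mem_univ α)] at this
    omega

end Levi

/-- A positive root to which no simple root can be added is dominant. -/
lemma latticeForm_simple_nonneg {γ : ι} (hγ : b.IsPos γ)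
    (h : ∀ (α : b.support) (k : ι), P.root k ≠ P.root γ + P.root (α : ι)) (α : b.support) :
    0 ≤ P.latticeForm (P.rootSpanMem ℤ γ) (P.rootSpanMem ℤ (α : ι)) := by
  by_contra! hα
  obtain ⟨k, hk⟩ := exists_root_eq_add_of_latticeForm_neg hα
    fun h' ↦ b.not_isPos_of_root_eq_neg h' (b.isPos_of_mem_support α.2) hγ
  exact h α k hk

/-- If no simple root can be added to a positive root, then no positive root can be. -/
lemma root_ne_add_of_isPos {γ : ι} (hγ : b.IsPos γ)
    (h : ∀ (α : b.support) (k : ι), P.root k ≠ P.root γ + P.root (α : ι)) {β : ι}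
    (hβ : b.IsPos β) (k : ι) : P.root k ≠ P.root γ + P.root β := by
  intro hk
  obtain ⟨n, hn⟩ := Int.eq_ofNat_of_zero_le hβ.partialHeight_univ_pos.le
  induction n using Nat.strong_induction_on generalizing β k with
  | _ n ih =>
    obtain ⟨α, hα, rfl | ⟨β', hβ', hsum⟩⟩ := hβ.mem_support_or_exists_eq_add
    · exact h α k hk
    -- γ is dominant and (β, α) > 0, so α can be subtracted from γ + β. This leaves the root γ + β'
    -- with β' of smaller height.
    · have hkα : 0 < P.latticeForm (P.rootSpanMem ℤ k) (P.rootSpanMem ℤ (α : ι)) := by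
        rw [rootSpanMem_add hk, map_add, LinearMap.add_apply]
        linarith [b.latticeForm_simple_nonneg hγ h α]
      have hne : k ≠ α := by
        rintro rfl
        have h1 := b.partialHeight_add Finset.univ hk
        rw [b.partialHeight_simple_of_mem _ (Finset.mem_univ α)] at h1
        linarith [hγ.partialHeight_univ_pos, hβ.partialHeight_univ_pos]
      obtain ⟨l, hl⟩ := exists_root_eq_sub_of_latticeForm_pos hkα hne
      have hht := b.partialHeight_add Finset.univ hsum
      rw [b.partialHeight_simple_of_mem _ (Finset.mem_univ α), hn] at hht
      obtain ⟨m, hm⟩ := Int.eq_ofNat_of_zero_le hβ'.partialHeight_univ_pos.le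
      exact ih m (by omega) hβ' l (by rw [hl, hk, hsum]; abel) hm

/-! ### The highest root. -/

section Highest

variable {ψ : ι}
  (hψ : ∀ φ : ι, P.root φ - P.root ψ ∈ AddSubmonoid.closure (P.root '' (b.support : Set ι)) →
    φ = ψ)

lemma root_mem_closure_of_isPos {i : ι} (hi : b.IsPos i) :
    P.root i ∈ AddSubmonoid.closure (P.root '' (b.support : Set ι)) :=
  hi.induction_on_add
    (p := fun i ↦ P.root i ∈ AddSubmonoid.closure (P.root '' (b.support : Set ι)))
    (fun j hj ↦ AddSubmonoid.subset_closure ⟨j, hj, rfl⟩) fun j l k hk hj hl ↦ by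
      rw [hk]
      exact add_mem hj (AddSubmonoid.subset_closure ⟨l, hl, rfl⟩)

include hψ

/-- If -ψ were positive, then (-ψ) - ψ = 2(-ψ) would be a sum of simple roots, against maximality.
-/
lemma isPos_of_maximal : b.IsPos ψ := by
  obtain ⟨k, hk⟩ := P.exists_root_eq_neg ψ
  refine (b.isPos_or_isPos_of_root_eq_neg hk).resolve_right fun h ↦ ?_
  have hc := b.root_mem_closure_of_isPos h
  have hkψ := hψ k (by
    rw [show P.root k - P.root ψ = P.root k + P.root k by rw [hk]; abel]
    exact add_mem hc hc)
  exact b.not_isPos_of_root_eq_neg hk (hkψ ▸ h) h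

omit [Fintype ι] [P.IsCrystallographic] in
lemma root_ne_add_of_maximal (α : b.support) (k : ι) :
    P.root k ≠ P.root ψ + P.root (α : ι) := by
  intro hk
  have hkψ := hψ k (by
    rw [hk, add_sub_cancel_left]
    exact AddSubmonoid.subset_closure ⟨α, α.2, rfl⟩)
  rw [hkψ, left_eq_add] at hk
  exact P.ne_zero _ hk

variable [P.IsReduced] [P.IsIrreducible]

/-- Suppose the coefficient at α vanishes. Then (ψ, α) is a sum of nonpositive terms, but ψ is
dominant, so α is orthogonal to every simple root in the support `T` of ψ. Thus the span of `T` is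
stable under all simple reflections, and by irreducibility it is everything, although it misses α.
-/
lemma rootCoeff_pos_of_maximal (α : b.support) : 0 < b.rootCoeff ψ α := by
  classical
  have hpos := b.isPos_of_maximal hψ
  have hdom := b.latticeForm_simple_nonneg hpos (b.root_ne_add_of_maximal hψ)
  refine (hpos.rootCoeff_nonneg α).lt_of_ne' fun hα ↦ ?_
  let T : Set ι := {i | ∃ h : i ∈ b.support, b.rootCoeff ψ ⟨i, h⟩ ≠ 0}
  have hle {α β : b.support} (hαβ : α ≠ β) :
      P.latticeForm (P.rootSpanMem ℤ (α : ι)) (P.rootSpanMem ℤ (β : ι)) ≤ 0 := by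
    by_contra! h
    rw [latticeForm_root_pos_iff] at h
    exact h.not_ge (b.pairingIn_le_zero_of_ne (fun h' ↦ hαβ (Subtype.ext h')) α.2 β.2)
  have horth (α β : b.support) (hα : b.rootCoeff ψ α = 0) (hβ : b.rootCoeff ψ β ≠ 0) :
      P.latticeForm (P.rootSpanMem ℤ (α : ι)) (P.rootSpanMem ℤ (β : ι)) = 0 := by
    have h0 := hdom α
    rw [← b.sum_rootCoeff_smul ψ, map_sum, LinearMap.sum_apply] at h0
    have hterm : ∀ γ ∈ Finset.univ, P.latticeForm (b.rootCoeff ψ γ • P.rootSpanMem ℤ (γ : ι))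
        (P.rootSpanMem ℤ (α : ι)) ≤ 0 := fun γ _ ↦ by
      rw [map_smul, LinearMap.smul_apply, smul_eq_mul]
      by_cases hγ : b.rootCoeff ψ γ = 0
      · rw [hγ, zero_mul]
      · exact mul_nonpos_of_nonneg_of_nonpos (hpos.rootCoeff_nonneg γ)
          (hle fun h ↦ hγ (h ▸ hα))
    have := (Finset.sum_eq_zero_iff_of_nonpos hterm).1
      (le_antisymm (Finset.sum_nonpos hterm) h0) β (Finset.mem_univ β)
    rw [map_smul, LinearMap.smul_apply, smul_eq_mul, mul_eq_zero] at this
    rw [P.latticeForm_comm]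
    exact this.resolve_left hβ
  have hroot {α β : b.support} (hα : b.rootCoeff ψ α = 0) (hβ : b.rootCoeff ψ β ≠ 0) :
      P.pairing (β : ι) (α : ι) = 0 := by
    rw [← P.algebraMap_pairingIn ℤ]
    have h2 := P.two_mul_latticeForm_root (β : ι) (α : ι)
    rw [P.latticeForm_comm, horth α β hα hβ, mul_zero, eq_comm, mul_eq_zero] at h2
    rw [h2.resolve_right (P.latticeForm_self_pos (rootSpanMem_ne_zero _)).ne', map_zero]
  have hinv : ∀ i, Submodule.span R (P.root '' T) ∈
      Module.End.invtSubmodule (P.reflection i).toLinearMap := by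
    rw [← b.forall_mem_support_invtSubmodule_iff]
    intro i hi
    by_cases hiT : b.rootCoeff ψ ⟨i, hi⟩ = 0
    · rw [Module.End.mem_invtSubmodule, Submodule.span_le]
      rintro _ ⟨j, ⟨hj, hjT⟩, rfl⟩
      have : P.reflection i (P.root j) = P.root j := by
        rw [reflection_apply_root, hroot (α := ⟨i, hi⟩) (β := ⟨j, hj⟩) hiT hjT, zero_smul,
          sub_zero]
      rw [SetLike.mem_coe, Submodule.mem_comap, LinearEquiv.coe_coe, this]
      exact Submodule.subset_span ⟨j, ⟨hj, hjT⟩, rfl⟩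
    · exact Submodule.mem_invtSubmodule_reflection_of_mem _ _
        (Submodule.subset_span ⟨i, ⟨hi, hiT⟩, rfl⟩)
  obtain ⟨α', hα'⟩ := b.exists_rootCoeff_ne_zero ψ
  have htop : Submodule.span R (P.root '' T) = ⊤ := by
    refine IsIrreducible.eq_top_of_invtSubmodule_reflection (P := P) _ hinv fun h ↦ ?_
    exact P.ne_zero (α' : ι) ((Submodule.eq_bot_iff _).1 h _
      (Submodule.subset_span ⟨α', ⟨α'.2, hα'⟩, rfl⟩))
  have hT : T ⊆ (b.support : Set ι) \ {(α : ι)} := by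
    rintro i ⟨hi, hiT⟩
    refine ⟨hi, fun h ↦ hiT ?_⟩
    rw [Set.mem_singleton_iff] at h
    subst h
    exact hα
  have hnot : P.root (α : ι) ∉ Submodule.span R (P.root '' T) := fun h ↦
    linearIndepOn_iff_notMem_span.1 b.linearIndepOn_root (α : ι) α.2
      (Submodule.span_mono (Set.image_mono hT) h)
  exact hnot (htop ▸ Submodule.mem_top)

/-- The highest root is the only positive root to which no simple root can be added. -/
lemma eq_of_forall_root_ne_add {γ : ι} (hγ : b.IsPos γ)
    (h : ∀ (α : b.support) (k : ι), P.root k ≠ P.root γ + P.root (α : ι)) : γ = ψ := by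
  have hdom := b.latticeForm_simple_nonneg hγ h
  have hnn (α : b.support) : 0 ≤ P.latticeForm (P.rootSpanMem ℤ γ)
      (b.rootCoeff ψ α • P.rootSpanMem ℤ (α : ι)) := by
    rw [map_smul, smul_eq_mul]
    exact mul_nonneg (b.rootCoeff_pos_of_maximal hψ α).le (hdom α)
  -- γ is dominant and ψ has positive coefficients, so a vanishing product would make γ orthogonal
  -- to every simple root, hence to itself.
  have hpos : 0 < P.latticeForm (P.rootSpanMem ℤ γ) (P.rootSpanMem ℤ ψ) := by
    rw [← b.sum_rootCoeff_smul ψ, map_sum]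
    refine (Finset.sum_nonneg fun α _ ↦ hnn α).lt_of_ne' fun h0 ↦ ?_
    have h0' (α : b.support) :
        P.latticeForm (P.rootSpanMem ℤ γ) (P.rootSpanMem ℤ (α : ι)) = 0 := by
      have := (Finset.sum_eq_zero_iff_of_nonneg fun α _ ↦ hnn α).1 h0 α (Finset.mem_univ α)
      rw [map_smul, smul_eq_mul, mul_eq_zero] at this
      exact this.resolve_left (b.rootCoeff_pos_of_maximal hψ α).ne'
    refine (P.latticeForm_self_pos (rootSpanMem_ne_zero γ)).ne' ?_
    rw [← congrArg (P.latticeForm (P.rootSpanMem ℤ γ)) (b.sum_rootCoeff_smul γ), map_sum]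
    exact Finset.sum_eq_zero fun α _ ↦ by rw [map_smul, h0', smul_zero]
  -- Otherwise γ - ψ is a root. If it is positive, ψ is not maximal; if it is negative, a positive
  -- root can be added to γ.
  by_contra hne
  obtain ⟨k, hk⟩ := exists_root_eq_sub_of_latticeForm_pos hpos hne
  obtain ⟨k', hk'⟩ := P.exists_root_eq_neg k
  rcases b.isPos_or_isPos_of_root_eq_neg hk' with h' | h'
  · exact hne (hψ γ (hk ▸ b.root_mem_closure_of_isPos h'))
  · exact b.root_ne_add_of_isPos hγ h h' ψ (by rw [hk', hk]; abel)

/-- For φ positive, a root of greatest height among those dominating φ coefficientwise admits no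
simple root to be added, so it is ψ. -/
lemma rootCoeff_le_of_maximal (φ : ι) (α : b.support) : b.rootCoeff φ α ≤ b.rootCoeff ψ α := by
  classical
  rcases b.rootCoeff_nonneg_or_nonpos φ with hφ | hφ
  swap
  · exact (hφ α).trans (b.rootCoeff_pos_of_maximal hψ α).le
  let F : Finset ι := Finset.univ.filter fun χ ↦ ∀ α, b.rootCoeff φ α ≤ b.rootCoeff χ α
  have hF {χ : ι} : χ ∈ F ↔ ∀ α, b.rootCoeff φ α ≤ b.rootCoeff χ α := by simp [F]
  obtain ⟨χ, hχF, hmax⟩ := F.exists_max_image (b.partialHeight Finset.univ)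
    ⟨φ, hF.2 fun _ ↦ le_rfl⟩
  suffices χ = ψ from this ▸ hF.1 hχF α
  obtain ⟨α', hα'⟩ := b.exists_rootCoeff_ne_zero φ
  refine b.eq_of_forall_root_ne_add hψ
    (b.isPos_of_rootCoeff_pos (((hφ α').lt_of_ne' hα').trans_le (hF.1 hχF α'))) fun β k hk ↦ ?_
  have hkF : k ∈ F := hF.2 fun α ↦ by
    rw [b.rootCoeff_add hk]
    linarith [hF.1 hχF α, b.rootCoeff_simple_nonneg β α]
  have := hmax k hkF
  rw [b.partialHeight_add _ hk, b.partialHeight_simple_of_mem _ (Finset.mem_univ β)] at this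
  omega

lemma partialHeight_le_of_maximal (J : Finset b.support) (φ : ι) :
    b.partialHeight J φ ≤ b.partialHeight J ψ :=
  Finset.sum_le_sum fun α _ ↦ b.rootCoeff_le_of_maximal hψ φ α

/-- To a root of positive, but not of maximal partial height one can add a root of partial
height one. -/
lemma exists_partialHeight_eq_one_root_add (J : Finset b.support) {γ : ι}
    (h0 : 0 < b.partialHeight J γ) (h1 : b.partialHeight J γ < b.partialHeight J ψ) :
    ∃ δ k, b.partialHeight J δ = 1 ∧ P.root k = P.root γ + P.root δ := by
  classical
  by_contra! hcon
  -- The roots that cannot be raised. If χ is one, β is a Levi root and χ + β + δ is a root, then χ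
  -- + δ is a root, or β + δ is a root of partial height one that raises χ. Both are excluded, so
  -- `A` is closed under adding Levi roots.
  let A : Set ι := {χ | 0 < b.partialHeight J χ ∧
    ∀ δ k, b.partialHeight J δ = 1 → P.root k ≠ P.root χ + P.root δ}
  have hA : ∀ χ ∈ A, ∀ β ε, (∀ α ∈ J, b.rootCoeff β α = 0) →
      P.root ε = P.root χ + P.root β → ε ∈ A := by
    rintro χ ⟨hχ0, hχ⟩ β ε hβ hε
    have hβ0 := (b.partialHeight_eq_zero_iff J).2 hβ
    refine ⟨by rw [b.partialHeight_add J hε, hβ0]; omega, fun δ k hδ hk ↦ ?_⟩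
    rcases exists_root_eq_add_of_root_add_add hε hk (fun h ↦ by
        rw [b.partialHeight_neg J h] at hχ0; omega) (fun h ↦ by
        rw [b.partialHeight_neg J h] at hβ0; omega) with ⟨l, hl⟩ | ⟨l, hl⟩
    · exact hχ δ l hδ hl
    · refine hχ l k ?_ (by rw [hk, hε, hl, add_assoc])
      rw [b.partialHeight_add J hl, hβ0, hδ, zero_add]
  let F : Finset ι := Finset.univ.filter fun χ ↦ ∀ α ∈ J, b.rootCoeff χ α = b.rootCoeff γ α
  have hF {χ : ι} : χ ∈ F ↔ ∀ α ∈ J, b.rootCoeff χ α = b.rootCoeff γ α := by simp [F]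
  obtain ⟨χ, hχF, hmax⟩ := F.exists_max_image (b.partialHeight Finset.univ)
    ⟨γ, hF.2 fun _ _ ↦ rfl⟩
  have hne : ∃ α ∈ J, b.rootCoeff γ α ≠ 0 := by
    by_contra! h
    rw [(b.partialHeight_eq_zero_iff J).2 h] at h0
    exact h0.false
  obtain ⟨hχ0, hχ⟩ := b.mem_of_forall_levi_add_mem J hA (γ := γ) ⟨h0, hcon⟩ (hF.1 hχF) hne
  -- Simple roots in `J` cannot be added because χ lies in `A`, the others because χ has greatest
  -- total height in its class.
  have hχψ : χ = ψ := by
    refine b.eq_of_forall_root_ne_add hψ (b.isPos_of_partialHeight_pos J hχ0) fun α k hk ↦ ?_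
    by_cases hα : α ∈ J
    · exact hχ α k (b.partialHeight_simple_of_mem J hα) hk
    · have := hmax k (hF.2 fun α' hα' ↦ by
        rw [b.rootCoeff_add hk, b.rootCoeff_simple_of_ne (β := α) (fun h ↦ hα (h ▸ hα')), add_zero,
          hF.1 hχF α' hα'])
      rw [b.partialHeight_add _ hk, b.partialHeight_simple_of_mem _ (Finset.mem_univ α)] at this
      omega
  refine h1.ne ?_
  rw [← hχψ, partialHeight, partialHeight, Finset.sum_congr rfl (hF.1 hχF)]

end Highest

/-! ### Closed sets of roots containing the positive roots. -/

section Parabolic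

variable {Q : Set ι} (hpos : ∀ i, b.IsPos i → i ∈ Q)
  (hadd : ∀ i ∈ Q, ∀ j ∈ Q, ∀ k, P.root k = P.root i + P.root j → k ∈ Q)
  {J : Finset b.support} (hJ : ∀ (α : b.support) (k : ι), P.root k = -P.root (α : ι) →
    (α ∈ J ↔ k ∉ Q))
include hpos hadd hJ

/-- Induction on building i from simple roots: for m = j + l with j and l positive, -j = -m + l and
-l = -m + j, so -m lies in `Q` exactly when -j and -l do. Partial heights of positive roots vanish
in the same additive way. -/
lemma neg_mem_parabolic_iff {i k : ι} (hi : b.IsPos i) (hk : P.root k = -P.root i) :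
    k ∈ Q ↔ b.partialHeight J i = 0 := by
  suffices h : b.IsPos i ∧ ∀ k, P.root k = -P.root i → (k ∈ Q ↔ b.partialHeight J i = 0) from
    h.2 k hk
  clear hk k
  refine hi.induction_on_add
    (p := fun i ↦ b.IsPos i ∧ ∀ k, P.root k = -P.root i → (k ∈ Q ↔ b.partialHeight J i = 0))
    (fun j hj ↦ ⟨b.isPos_of_mem_support hj, fun k hk ↦ ?_⟩)
    fun j l m hm hj hl ↦ ⟨hj.1.add (b.isPos_of_mem_support hl) hm, fun k hk ↦ ?_⟩
  · have := hJ ⟨j, hj⟩ k hk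
    by_cases hjJ : (⟨j, hj⟩ : b.support) ∈ J
    · simp [b.partialHeight_simple_of_mem J hjJ, this.1 hjJ]
    · simp [b.partialHeight_simple_of_notMem J hjJ, not_not.1 (mt this.2 hjJ)]
  · obtain ⟨j', hj'⟩ := P.exists_root_eq_neg j
    obtain ⟨l', hl'⟩ := P.exists_root_eq_neg l
    have hlQ : l' ∈ Q ↔ b.partialHeight J l = 0 := by
      have := hJ ⟨l, hl⟩ l' hl'
      by_cases hlJ : (⟨l, hl⟩ : b.support) ∈ J
      · simp [b.partialHeight_simple_of_mem J hlJ, this.1 hlJ]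
      · simp [b.partialHeight_simple_of_notMem J hlJ, not_not.1 (mt this.2 hlJ)]
    have h1 := hj.1.partialHeight_nonneg J
    have h2 := (b.isPos_of_mem_support hl).partialHeight_nonneg J
    have h3 : b.partialHeight J m = 0 ↔ b.partialHeight J j = 0 ∧ b.partialHeight J l = 0 := by
      rw [b.partialHeight_add J hm]; omega
    rw [h3, ← hj.2 j' hj', ← hlQ]
    refine ⟨fun h ↦ ⟨hadd k h l (hpos l (b.isPos_of_mem_support hl)) j' ?_,
      hadd k h j (hpos j hj.1) l' ?_⟩, fun h ↦ hadd j' h.1 l' h.2 k ?_⟩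
    · rw [hj', hk, hm]; abel
    · rw [hl', hk, hm]; abel
    · rw [hj', hl', hk, hm]; abel

lemma mem_parabolic_iff (i : ι) : i ∈ Q ↔ 0 ≤ b.partialHeight J i := by
  obtain ⟨k, hk⟩ := P.exists_root_eq_neg i
  rcases b.isPos_or_isPos_of_root_eq_neg hk with h | h
  · simp [hpos i h, h.partialHeight_nonneg J]
  · have hi : P.root i = -P.root k := by rw [hk, neg_neg]
    rw [b.neg_mem_parabolic_iff hpos hadd hJ h hi, b.partialHeight_neg J hi]
    have := h.partialHeight_nonneg J
    omega

end Parabolic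

end RootPairing.Base

end

noncomputable section

namespace LeviRoots

/-! ### Spans of brackets and nilpotency. -/

section Bracket

variable {𝔤 : Type*} [LieRing 𝔤] [LieAlgebra ℂ 𝔤]

lemma bracket_eq_map₂ (U V : Submodule ℂ 𝔤) :
    bracket U V = Submodule.map₂ (LieModule.toEnd ℂ 𝔤 𝔤 : 𝔤 →ₗ[ℂ] Module.End ℂ 𝔤) U V := by
  rw [bracket, Submodule.map₂_eq_span_image2]
  rfl

lemma bracket_le {U V W : Submodule ℂ 𝔤} :
    bracket U V ≤ W ↔ ∀ x ∈ U, ∀ y ∈ V, ⁅x, y⁆ ∈ W := by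
  rw [bracket_eq_map₂, Submodule.map₂_le]; rfl

lemma lie_mem_bracket {U V : Submodule ℂ 𝔤} {x y : 𝔤} (hx : x ∈ U) (hy : y ∈ V) :
    ⁅x, y⁆ ∈ bracket U V :=
  Submodule.subset_span ⟨x, hx, y, hy, rfl⟩

/-- The lower central series of a subalgebra, computed in the ambient Lie algebra. -/
lemma map_lowerCentralSeries_succ (𝔫 : LieSubalgebra ℂ 𝔤) (i : ℕ) :
    (LieModule.lowerCentralSeries ℂ 𝔫 𝔫 (i + 1)).toSubmodule.map 𝔫.toSubmodule.subtype =
      bracket 𝔫.toSubmodule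
        ((LieModule.lowerCentralSeries ℂ 𝔫 𝔫 i).toSubmodule.map 𝔫.toSubmodule.subtype) := by
  rw [LieModule.lowerCentralSeries_succ, LieSubmodule.lieIdeal_oper_eq_linear_span',
    Submodule.map_span, bracket]
  congr 1
  ext z
  constructor
  · rintro ⟨_, ⟨x, -, y, hy, rfl⟩, rfl⟩
    exact ⟨x, x.2, y, ⟨y, hy, rfl⟩, rfl⟩
  · rintro ⟨x, hx, _, ⟨y, hy, rfl⟩, rfl⟩
    exact ⟨⁅(⟨x, hx⟩ : 𝔫), y⁆, ⟨⟨x, hx⟩, LieSubmodule.mem_top _, y, hy, rfl⟩, rfl⟩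

/-- In a nilpotent Lie algebra no `ad x` has a nonzero eigenvalue. -/
lemma eq_zero_of_lie_eq_smul {L : Type*} [LieRing L] [LieAlgebra ℂ L] [LieRing.IsNilpotent L]
    {x y : L} {c : ℂ} (hc : c ≠ 0) (h : ⁅x, y⁆ = c • y) : y = 0 := by
  obtain ⟨k, hk⟩ := LieModule.IsNilpotent.nilpotent ℂ L L
  have hy : ∀ i, y ∈ LieModule.lowerCentralSeries ℂ L L i := fun i ↦ by
    induction i with
    | zero => simp
    | succ i ih =>
      have : ⁅x, y⁆ ∈ LieModule.lowerCentralSeries ℂ L L (i + 1) := by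
        rw [LieModule.lowerCentralSeries_succ]
        exact LieSubmodule.lie_mem_lie (LieSubmodule.mem_top x) ih
      rw [h] at this
      simpa [smul_smul, inv_mul_cancel₀ hc] using
        (LieModule.lowerCentralSeries ℂ L L (i + 1)).smul_mem c⁻¹ this
  simpa [hk] using hy k

end Bracket

/-! ### Root spaces, their brackets, and subspaces stable under the Cartan subalgebra. -/

section RootSpaces

variable {𝔤 : Type*} [LieRing 𝔤] [LieAlgebra ℂ 𝔤] [FiniteDimensional ℂ 𝔤]
  [LieAlgebra.IsSimple ℂ 𝔤] {H : LieSubalgebra ℂ 𝔤} [H.IsCartanSubalgebra]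

lemma lie_eq_smul_of_mem_rootLine {φ : H.root} {x : 𝔤} (hx : x ∈ rootLine φ) (h : H) :
    ⁅(h : 𝔤), x⁆ = (rootSystem H).root φ h • x :=
  lie_eq_smul_of_mem_rootSpace hx h

omit [IsSimple ℂ 𝔤] in
lemma exists_ne_zero_mem_rootLine (φ : H.root) : ∃ x ∈ rootLine φ, x ≠ 0 :=
  (φ : LieModule.Weight ℂ H 𝔤).exists_ne_zero

lemma rootLine_le_of_mem {φ : H.root} {U : Submodule ℂ 𝔤} {x : 𝔤} (hx : x ∈ rootLine φ)
    (hx0 : x ≠ 0) (hxU : x ∈ U) : rootLine φ ≤ U := by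
  intro y hy
  obtain ⟨c, hc⟩ := (finrank_eq_one_iff_of_nonzero' (⟨x, hx⟩ : rootSpace H φ.1)
    (by simpa [Subtype.ext_iff] using hx0)).1
    (finrank_rootSpace_eq_one φ.1 (H.isNonZero_coe_root φ)) ⟨y, hy⟩
  have : c • x = y := congrArg Subtype.val hc
  exact this ▸ U.smul_mem c hxU

lemma coe_eq_add_of_root_eq_add {φ ψ χ : H.root}
    (h : (rootSystem H).root χ = (rootSystem H).root φ + (rootSystem H).root ψ) :
    (χ.1 : H → ℂ) = (φ.1 : H → ℂ) + ψ.1 :=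
  funext fun x ↦ LinearMap.congr_fun h x

lemma lie_mem_rootLine {φ ψ χ : H.root}
    (h : (rootSystem H).root χ = (rootSystem H).root φ + (rootSystem H).root ψ) {x y : 𝔤}
    (hx : x ∈ rootLine φ) (hy : y ∈ rootLine ψ) : ⁅x, y⁆ ∈ rootLine χ := by
  have := lie_mem_genWeightSpace_of_mem_genWeightSpace hx hy
  rwa [← coe_eq_add_of_root_eq_add h] at this

lemma exists_root_eq_of_rootSpace_ne_bot {f : Dual ℂ H} (hf : f ≠ 0)
    (h : rootSpace H (f : H → ℂ) ≠ ⊥) : ∃ χ, (rootSystem H).root χ = f := by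
  let w : LieModule.Weight ℂ H 𝔤 := ⟨f, h⟩
  have hw : w.IsNonZero := fun h0 ↦ hf (LinearMap.ext fun x ↦ congrFun h0 x)
  exact ⟨⟨w, by simpa [LieSubalgebra.root] using hw⟩, LinearMap.ext fun x ↦ rfl⟩

lemma lie_eq_zero_of_forall_root_ne {φ ψ : H.root}
    (h0 : (rootSystem H).root φ ≠ -(rootSystem H).root ψ)
    (h : ∀ χ, (rootSystem H).root χ ≠ (rootSystem H).root φ + (rootSystem H).root ψ) {x y : 𝔤}
    (hx : x ∈ rootLine φ) (hy : y ∈ rootLine ψ) : ⁅x, y⁆ = 0 := by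
  have hmem := lie_mem_genWeightSpace_of_mem_genWeightSpace hx hy
  by_contra hne
  obtain ⟨χ, hχ⟩ := exists_root_eq_of_rootSpace_ne_bot
    (f := (rootSystem H).root φ + (rootSystem H).root ψ)
    (fun h' ↦ h0 (eq_neg_of_add_eq_zero_left h'))
    (fun hbot ↦ hne (by
      have : ⁅x, y⁆ ∈ rootSpace H ((rootSystem H).root φ + (rootSystem H).root ψ : Dual ℂ H) :=
        hmem
      rwa [hbot, LieSubmodule.mem_bot] at this))
  exact h χ hχ

open LieModule in
/-- The bracket of two root vectors whose roots add up to a root is not zero. -/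
lemma lie_ne_zero_of_root_add {φ ψ χ : H.root}
    (h : (rootSystem H).root χ = (rootSystem H).root φ + (rootSystem H).root ψ) {x y : 𝔤}
    (hx : x ∈ rootLine φ) (hx0 : x ≠ 0) (hy : y ∈ rootLine ψ) (hy0 : y ≠ 0) : ⁅x, y⁆ ≠ 0 := by
  have hφ := H.isNonZero_coe_root φ
  obtain ⟨_, e, f, ht, he, hf⟩ := exists_isSl2Triple_of_weight_isNonZero hφ
  obtain rfl := ht.h_eq_coroot hφ he hf
  obtain ⟨z, hz, hz0⟩ := (chainTop φ.1 ψ.1).exists_ne_zero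
  set r := chainTopCoeff φ.1 ψ.1 with hr
  have hr1 : 1 ≤ r := by
    have := (rootSpace_zsmul_add_ne_bot_iff φ.1 ψ.1 hφ 1).1 (by
      rw [one_smul, ← coe_eq_add_of_root_eq_add h]
      exact χ.1.genWeightSpace_ne_bot)
    exact_mod_cast this.1
  have hrl : r ≤ chainLength φ.1 ψ.1 := chainTopCoeff_le_chainLength _ _
  have prim : ht.HasPrimitiveVectorWith z (chainLength φ.1 ψ.1 : ℂ) :=
    have := lie_mem_genWeightSpace_of_mem_genWeightSpace he hz
    ⟨hz0, (chainLength_smul _ _ hz).symm, by rwa [genWeightSpace_add_chainTop _ _ hφ] at this⟩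
  obtain ⟨s, hs⟩ : ∃ s, r = s + 1 := ⟨r - 1, by omega⟩
  have hmem : ((toEnd ℂ 𝔤 𝔤 f) ^ r) z ∈ rootLine ψ := by
    have := toEnd_pow_apply_mem hf hz r
    rw [coe_chainTop', ← hr, ← add_assoc, smul_neg, neg_add_cancel, zero_add] at this
    exact this
  have hne := prim.pow_toEnd_f_ne_zero_of_eq_nat rfl hrl
  intro hxy
  have hey : ⁅e, y⁆ = 0 := by
    have : rootLine φ ≤ (LinearMap.ker ((toEnd ℂ 𝔤 𝔤 : 𝔤 →ₗ[ℂ] Module.End ℂ 𝔤).flip y)) :=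
      rootLine_le_of_mem hx hx0 (by simpa using hxy)
    simpa using this he
  have hez : ⁅e, ((toEnd ℂ 𝔤 𝔤 f) ^ r) z⁆ = 0 := by
    have : rootLine ψ ≤ LinearMap.ker (toEnd ℂ 𝔤 𝔤 e) :=
      rootLine_le_of_mem hy hy0 (by simpa using hey)
    simpa using this hmem
  rw [hs, prim.lie_e_pow_succ_toEnd_f] at hez
  have hne' := prim.pow_toEnd_f_ne_zero_of_eq_nat rfl (i := s) (by omega)
  rcases smul_eq_zero.1 hez with h1 | h1
  · rcases mul_eq_zero.1 h1 with h2 | h2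
    · exact Nat.cast_add_one_ne_zero s h2
    · rw [sub_eq_zero, Nat.cast_inj] at h2
      omega
  · exact hne' h1

/-- The sum of the root spaces of a set of roots. -/
def rootSum (s : Set H.root) : Submodule ℂ 𝔤 := ⨆ φ ∈ s, rootLine φ

omit [IsSimple ℂ 𝔤] in
lemma rootSum_le_iff {s : Set H.root} {U : Submodule ℂ 𝔤} :
    rootSum s ≤ U ↔ ∀ φ ∈ s, rootLine φ ≤ U :=
  iSup₂_le_iff

omit [IsSimple ℂ 𝔤] in
lemma rootLine_le_rootSum {s : Set H.root} {φ : H.root} (h : φ ∈ s) : rootLine φ ≤ rootSum s :=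
  le_iSup₂_of_le φ h le_rfl

omit [IsSimple ℂ 𝔤] in
lemma rootSum_mono {s t : Set H.root} (h : s ⊆ t) : rootSum s ≤ rootSum t :=
  rootSum_le_iff.2 fun _ hφ ↦ rootLine_le_rootSum (h hφ)

omit [FiniteDimensional ℂ 𝔤] [IsSimple ℂ 𝔤] in
lemma disjoint_rootSpace_iSup (f : H → ℂ) :
    Disjoint (rootSpace H f).toSubmodule (⨆ g, ⨆ _ : g ≠ f, (rootSpace H g).toSubmodule) := by
  have := LieModule.iSupIndep_genWeightSpace ℂ H 𝔤 f
  rw [← LieSubmodule.disjoint_toSubmodule] at this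
  simpa only [LieSubmodule.iSup_toSubmodule] using this

omit [IsSimple ℂ 𝔤] in
lemma cartan_eq_rootSpace_zero : H.toSubmodule = (rootSpace H (0 : H → ℂ)).toSubmodule := by
  rw [rootSpace_zero_eq]; rfl

omit [IsSimple ℂ 𝔤] in
lemma rootLine_le_cartan_sup_rootSum_iff {s : Set H.root} {φ : H.root} :
    rootLine φ ≤ H.toSubmodule ⊔ rootSum s ↔ φ ∈ s := by
  refine ⟨fun h ↦ ?_, fun h ↦ (rootLine_le_rootSum h).trans le_sup_right⟩
  by_contra hφ
  have hle : H.toSubmodule ⊔ rootSum s ≤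
      ⨆ g, ⨆ _ : g ≠ (φ.1 : H → ℂ), (rootSpace H g).toSubmodule := by
    refine sup_le ?_ (rootSum_le_iff.2 fun ψ hψ ↦ ?_)
    · rw [cartan_eq_rootSpace_zero]
      exact le_iSup₂_of_le 0 (Ne.symm (H.isNonZero_coe_root φ)) le_rfl
    · refine le_iSup₂_of_le (ψ.1 : H → ℂ) (fun h' ↦ hφ ?_) le_rfl
      rwa [← Subtype.ext (DFunLike.coe_injective h')]
  obtain ⟨x, hx, hx0⟩ := exists_ne_zero_mem_rootLine φ
  exact hx0 ((Submodule.disjoint_def.1 (disjoint_rootSpace_iSup (φ.1 : H → ℂ))) x hx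
    (hle (h hx)))

omit [IsSimple ℂ 𝔤] in
lemma rootLine_le_rootSum_iff {s : Set H.root} {φ : H.root} :
    rootLine φ ≤ rootSum s ↔ φ ∈ s :=
  ⟨fun h ↦ rootLine_le_cartan_sup_rootSum_iff.1 (h.trans le_sup_right), rootLine_le_rootSum⟩

omit [IsSimple ℂ 𝔤] in
lemma rootSum_le_rootSum_iff {s t : Set H.root} : rootSum (H := H) s ≤ rootSum t ↔ s ⊆ t := by
  simp only [rootSum_le_iff, rootLine_le_rootSum_iff, Set.subset_def]

omit [IsSimple ℂ 𝔤] in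
lemma rootSum_injective : Function.Injective (rootSum (H := H)) := fun _ _ h ↦
  (rootSum_le_rootSum_iff.1 h.le).antisymm (rootSum_le_rootSum_iff.1 h.ge)

omit [IsSimple ℂ 𝔤] in
lemma rootSum_empty : rootSum (∅ : Set H.root) = ⊥ := by simp [rootSum]

omit [IsSimple ℂ 𝔤] in
lemma disjoint_cartan_rootSum (s : Set H.root) : Disjoint H.toSubmodule (rootSum s) := by
  rw [cartan_eq_rootSpace_zero]
  exact (disjoint_rootSpace_iSup (0 : H → ℂ)).mono_right
    (rootSum_le_iff.2 fun ψ _ ↦ le_iSup₂_of_le (ψ.1 : H → ℂ) (H.isNonZero_coe_root ψ) le_rfl)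

/-- A subspace stable under the Cartan subalgebra is the sum of its intersection with the Cartan
subalgebra and of the root spaces it contains. -/
lemma eq_inf_cartan_sup_rootSum {U : Submodule ℂ 𝔤} (hU : ∀ h ∈ H, ∀ x ∈ U, ⁅h, x⁆ ∈ U) :
    U = U ⊓ H.toSubmodule ⊔ rootSum {φ : H.root | rootLine φ ≤ U} := by
  refine le_antisymm ?_ (sup_le inf_le_left (rootSum_le_iff.2 fun _ h ↦ h))
  -- A submodule for 𝔥 is the sum of its intersections with the weight spaces; since root spaces are
  -- lines, each such intersection is zero or the full root space.
  let N : LieSubmodule ℂ H 𝔤 := { U with lie_mem := fun {h x} hx ↦ hU h h.2 x hx }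
  have hN := congrArg LieSubmodule.toSubmodule (LieModule.eq_iSup_inf_genWeightSpace (N := N))
  rw [LieSubmodule.iSup_toSubmodule] at hN
  change N.toSubmodule ≤ _
  rw [hN]
  refine iSup_le fun χ ↦ ?_
  rw [LieSubmodule.inf_toSubmodule]
  by_cases hχ : χ.IsZero
  · rw [show (χ : H → ℂ) = 0 from hχ, ← cartan_eq_rootSpace_zero]
    exact le_sup_left
  · refine le_sup_of_le_right ?_
    let φ : H.root := ⟨χ, by simpa [LieSubalgebra.root] using hχ⟩
    rintro x ⟨hx1, hx2⟩
    by_cases hx0 : x = 0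
    · rw [hx0]; exact Submodule.zero_mem _
    · have hxφ : x ∈ rootLine φ := hx2
      have hle : rootLine φ ≤ U := rootLine_le_of_mem hxφ hx0 hx1
      exact rootLine_le_rootSum (s := {φ : H.root | rootLine φ ≤ U}) hle hxφ

lemma eq_rootSum_of_disjoint {U : Submodule ℂ 𝔤} (hU : ∀ h ∈ H, ∀ x ∈ U, ⁅h, x⁆ ∈ U)
    (hd : Disjoint U H.toSubmodule) : U = rootSum {φ : H.root | rootLine φ ≤ U} := by
  conv_lhs => rw [eq_inf_cartan_sup_rootSum hU, hd.eq_bot, bot_sup_eq]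

lemma eq_cartan_sup_rootSum {U : Submodule ℂ 𝔤} (hU : ∀ h ∈ H, ∀ x ∈ U, ⁅h, x⁆ ∈ U)
    (hd : H.toSubmodule ≤ U) : U = H.toSubmodule ⊔ rootSum {φ : H.root | rootLine φ ≤ U} := by
  conv_lhs => rw [eq_inf_cartan_sup_rootSum hU, inf_eq_right.2 hd]

lemma lie_mem_rootSum_of_mem_cartan {s : Set H.root} {h x : 𝔤} (hh : h ∈ H)
    (hx : x ∈ rootSum s) : ⁅h, x⁆ ∈ rootSum s := by
  have : rootSum s ≤ (rootSum s).comap (LieModule.toEnd ℂ 𝔤 𝔤 h) :=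
    rootSum_le_iff.2 fun φ hφ y hy ↦ by
      have := lie_eq_smul_of_mem_rootLine hy ⟨h, hh⟩
      rw [Submodule.mem_comap, LieModule.toEnd_apply_apply, this]
      exact Submodule.smul_mem _ _ (rootLine_le_rootSum hφ hy)
  exact this hx

lemma lie_mem_rootSum {s t u : Set H.root}
    (h0 : ∀ φ ∈ s, ∀ ψ ∈ t, (rootSystem H).root φ ≠ -(rootSystem H).root ψ)
    (hu : ∀ φ ∈ s, ∀ ψ ∈ t, ∀ χ,
      (rootSystem H).root χ = (rootSystem H).root φ + (rootSystem H).root ψ → χ ∈ u)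
    {x y : 𝔤} (hx : x ∈ rootSum s) (hy : y ∈ rootSum t) : ⁅x, y⁆ ∈ rootSum u := by
  refine bracket_le.1 ?_ x hx y hy
  simp only [bracket_eq_map₂, rootSum, Submodule.map₂_iSup_left, Submodule.map₂_iSup_right,
    iSup_le_iff]
  intro ψ hψ φ hφ
  rw [← bracket_eq_map₂, bracket_le]
  intro x hx y hy
  by_cases h : ∃ χ, (rootSystem H).root χ = (rootSystem H).root φ + (rootSystem H).root ψ
  · obtain ⟨χ, hχ⟩ := h
    exact rootLine_le_rootSum (hu φ hφ ψ hψ χ hχ) (lie_mem_rootLine hχ hx hy)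
  · rw [lie_eq_zero_of_forall_root_ne (h0 φ hφ ψ hψ) (fun χ hχ ↦ h ⟨χ, hχ⟩) hx hy]
    exact Submodule.zero_mem _

/-- The dictionary between brackets and sums of roots. Opposite roots are excluded because their
bracket falls into the Cartan subalgebra. -/
lemma bracket_rootSum {s t : Set H.root}
    (h0 : ∀ φ ∈ s, ∀ ψ ∈ t, (rootSystem H).root φ ≠ -(rootSystem H).root ψ) :
    bracket (rootSum s) (rootSum t) = rootSum {χ : H.root | ∃ φ ∈ s, ∃ ψ ∈ t,
      (rootSystem H).root χ = (rootSystem H).root φ + (rootSystem H).root ψ} := by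
  refine le_antisymm (bracket_le.2 fun x hx y hy ↦ lie_mem_rootSum h0
    (fun φ hφ ψ hψ χ hχ ↦ by exact ⟨φ, hφ, ψ, hψ, hχ⟩) hx hy) (rootSum_le_iff.2 ?_)
  rintro χ ⟨φ, hφ, ψ, hψ, hχ⟩
  obtain ⟨x, hx, hx0⟩ := exists_ne_zero_mem_rootLine φ
  obtain ⟨y, hy, hy0⟩ := exists_ne_zero_mem_rootLine ψ
  exact rootLine_le_of_mem (lie_mem_rootLine hχ hx hy) (lie_ne_zero_of_root_add hχ hx hx0 hy hy0)
    (lie_mem_bracket (rootLine_le_rootSum hφ hx) (rootLine_le_rootSum hψ hy))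

end RootSpaces

end LeviRoots

end

noncomputable section

/-! ### Splitting a class of roots of partial height at least two. -/

namespace RootPairing.Base

variable {ι R M N : Type*} [Fintype ι] [Field R] [CharZero R] [AddCommGroup M] [Module R M]
  [AddCommGroup N] [Module R N] {P : RootPairing ι R M N}
  (b : P.Base) [P.IsCrystallographic] (J : Finset b.support)

omit [Fintype ι] [P.IsCrystallographic] in
lemma partialHeight_congr {φ ψ : ι} (h : ∀ α ∈ J, b.rootCoeff φ α = b.rootCoeff ψ α) :
    b.partialHeight J φ = b.partialHeight J ψ :=
  Finset.sum_congr rfl h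

omit [Fintype ι] [P.IsCrystallographic] in
lemma root_ne_neg_of_partialHeight_add_pos {φ ψ : ι}
    (h : 0 < b.partialHeight J φ + b.partialHeight J ψ) : P.root φ ≠ -P.root ψ := fun h' ↦ by
  rw [b.partialHeight_neg J h'] at h
  omega

/-- For a class of roots with given coefficients at `J`, of partial height at least two, there are
a simple root `α` in `J` and a root `μ` such that all roots of the class are sums of two roots with
the same coefficients at `J` as `α` and `μ`. -/
lemma exists_forall_root_eq_add [P.IsReduced] {γ : ι} (hγ : 2 ≤ b.partialHeight J γ) :
    ∃ α ∈ J, ∃ μ, (∀ a ∈ J, b.rootCoeff γ a = b.rootCoeff α a + b.rootCoeff μ a) ∧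
      ∀ χ, (∀ a ∈ J, b.rootCoeff χ a = b.rootCoeff γ a) → ∃ φ ψ,
        (∀ a ∈ J, b.rootCoeff φ a = b.rootCoeff α a) ∧
        (∀ a ∈ J, b.rootCoeff ψ a = b.rootCoeff μ a) ∧ P.root χ = P.root φ + P.root ψ := by
  obtain ⟨δ, μ, α, hα, hδγ, hδ⟩ := b.exists_root_eq_add_of_two_le_partialHeight J hγ
  have hα1 := b.partialHeight_simple_of_mem J hα
  have hδ2 : 2 ≤ b.partialHeight J δ := by rwa [b.partialHeight_congr J hδγ]
  have hμ : 1 ≤ b.partialHeight J μ := by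
    have := b.partialHeight_add J hδ
    omega
  refine ⟨α, hα, μ, fun a ha ↦ by rw [← hδγ a ha, b.rootCoeff_add hδ, add_comm],
    fun χ hχ ↦ ?_⟩
  let A : Set ι := {χ | ∃ φ ψ, (∀ a ∈ J, b.rootCoeff φ a = b.rootCoeff α a) ∧
    (∀ a ∈ J, b.rootCoeff ψ a = b.rootCoeff μ a) ∧ P.root χ = P.root φ + P.root ψ}
  -- `A` contains δ = α + μ. It is closed because a Levi root added to φ + ψ can be absorbed into
  -- one of the two summands.
  refine b.mem_of_forall_levi_add_mem J (A := A) ?_ (γ := δ)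
    ⟨α, μ, fun _ _ ↦ rfl, fun _ _ ↦ rfl, by rw [hδ, add_comm]⟩
    (fun a ha ↦ (hχ a ha).trans (hδγ a ha).symm) ?_
  · rintro χ ⟨φ, ψ, hφ, hψ, hχ⟩ β ε hβ hε
    have hβ0 := (b.partialHeight_eq_zero_iff J).2 hβ
    have hφ1 := b.partialHeight_congr J hφ
    have hψ1 := b.partialHeight_congr J hψ
    rcases exists_root_eq_add_of_root_add_add hχ hε
      (b.root_ne_neg_of_partialHeight_add_pos J (by omega))
      (b.root_ne_neg_of_partialHeight_add_pos J (by omega)) with ⟨k, hk⟩ | ⟨k, hk⟩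
    · exact ⟨k, ψ, fun a ha ↦ by rw [b.rootCoeff_add hk, hβ a ha, add_zero, hφ a ha], hψ,
        by rw [hε, hχ, hk]; abel⟩
    · exact ⟨φ, k, hφ, fun a ha ↦ by rw [b.rootCoeff_add hk, hβ a ha, add_zero, hψ a ha],
        by rw [hε, hχ, hk, add_assoc]⟩
  · by_contra! h
    rw [(b.partialHeight_eq_zero_iff J).2 h] at hδ2
    omega

end RootPairing.Base

namespace LeviRoots

variable {𝔤 : Type*} [LieRing 𝔤] [LieAlgebra ℂ 𝔤] [FiniteDimensional ℂ 𝔤]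
  [LieAlgebra.IsSimple ℂ 𝔤] {H : LieSubalgebra ℂ 𝔤} [H.IsCartanSubalgebra]
  (b : (rootSystem H).Base) (J : Finset b.support)

/-! ### The lower central series as a filtration by partial height. -/

section LowerSeries

variable {𝔫 : LieSubalgebra ℂ 𝔤}
  (h𝔫 : 𝔫.toSubmodule = rootSum {φ : H.root | 1 ≤ b.partialHeight J φ})
include h𝔫

/-- Partial height is additive, and a root of partial height ≥ 2 splits off a summand of partial
height exactly one, so each bracket with 𝔫 raises the threshold by exactly one. It starts at 1 for
index 0. -/
lemma map_lowerCentralSeries_eq_rootSum (i : ℕ) :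
    (LieModule.lowerCentralSeries ℂ 𝔫 𝔫 i).toSubmodule.map 𝔫.toSubmodule.subtype =
      rootSum {φ : H.root | (i : ℤ) + 1 ≤ b.partialHeight J φ} := by
  induction i with
  | zero =>
    rw [LieModule.lowerCentralSeries_zero, LieSubmodule.top_toSubmodule]
    simpa using h𝔫
  | succ i ih =>
    rw [map_lowerCentralSeries_succ, ih, h𝔫, bracket_rootSum fun φ hφ ψ hψ ↦
      b.root_ne_neg_of_partialHeight_add_pos J
        (by simp only [Set.mem_ofPred_eq] at hφ hψ; omega)]
    congr 1
    ext χ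
    simp only [Set.mem_ofPred_eq]
    push_cast
    constructor
    · rintro ⟨φ, hφ, ψ, hψ, h⟩
      rw [b.partialHeight_add J h]
      omega
    · intro hχ
      obtain ⟨α, hα, μ, hsum, h⟩ := b.exists_forall_root_eq_add J (γ := χ) (by omega)
      obtain ⟨φ, ψ, hφ, -, hχ'⟩ := h χ fun _ _ ↦ rfl
      have h1 := b.partialHeight_congr J hφ
      rw [b.partialHeight_simple_of_mem J hα] at h1
      have h2 := b.partialHeight_add J hχ'
      exact ⟨φ, by omega, ψ, by omega, hχ'⟩

lemma lowerCentralSeries_eq_bot_iff (i : ℕ) :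
    LieModule.lowerCentralSeries ℂ 𝔫 𝔫 i = ⊥ ↔ ∀ φ : H.root, b.partialHeight J φ ≤ i := by
  have h := map_lowerCentralSeries_eq_rootSum b J h𝔫 i
  rw [← LieSubmodule.toSubmodule_eq_bot,
    ← (Submodule.map_injective_of_injective 𝔫.toSubmodule.injective_subtype).eq_iff,
    Submodule.map_bot, h, ← rootSum_empty (H := H), rootSum_injective.eq_iff, Set.eq_empty_iff_forall_notMem]
  exact forall_congr' fun φ ↦ by simp only [Set.mem_ofPred_eq]; omega

lemma isNilpotent_of_toSubmodule_eq_rootSum : LieRing.IsNilpotent 𝔫 := by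
  obtain ⟨m, hm⟩ := (Set.finite_range fun φ : H.root ↦ b.partialHeight J φ).bddAbove
  exact (LieModule.isNilpotent_iff ℂ 𝔫 𝔫).2 ⟨m.toNat,
    (lowerCentralSeries_eq_bot_iff b J h𝔫 _).2 fun φ ↦
      (hm ⟨φ, rfl⟩).trans (Int.self_le_toNat m)⟩

end LowerSeries

/-- The sum of the root spaces of positive partial height. -/
def positivePart : LieSubalgebra ℂ 𝔤 where
  __ := rootSum {φ : H.root | 1 ≤ b.partialHeight J φ}
  lie_mem' {x y} hx hy :=
    lie_mem_rootSum (fun φ hφ ψ hψ ↦ b.root_ne_neg_of_partialHeight_add_pos J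
        (by simp only [Set.mem_ofPred_eq] at hφ hψ; omega))
      (fun φ hφ ψ hψ χ hχ ↦ by
        simp only [Set.mem_ofPred_eq] at hφ hψ ⊢
        rw [b.partialHeight_add J hχ]
        omega) hx hy

lemma exists_root_apply_ne_zero {h : H} (hh : h ≠ 0) :
    ∃ φ : H.root, (rootSystem H).root φ h ≠ 0 := by
  by_contra! hcon
  apply hh
  have : h ∈ ⨅ α : LieModule.Weight ℂ H 𝔤, α.ker := by
    refine (Submodule.mem_iInf _).2 fun χ ↦ ?_
    by_cases hχ : χ.IsZero
    · exact LinearMap.mem_ker.2 (congrFun hχ h)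
    · exact LinearMap.mem_ker.2 (hcon ⟨χ, by simpa [LieSubalgebra.root] using hχ⟩)
  rwa [iInf_ker_weight_eq_bot, Submodule.mem_bot] at this

/-! ### Nilradical and Levi factor of a standard parabolic subalgebra. -/

section Nilradical

variable {𝔮 : LieSubalgebra ℂ 𝔤}
  (h𝔮 : 𝔮.toSubmodule = H.toSubmodule ⊔ rootSum {φ : H.root | 0 ≤ b.partialHeight J φ})
include h𝔮

lemma cartan_le_parabolic : H ≤ 𝔮 := by
  rw [← LieSubalgebra.toSubmodule_le_toSubmodule, h𝔮]
  exact le_sup_left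

lemma rootLine_le_parabolic_iff {φ : H.root} :
    rootLine φ ≤ 𝔮.toSubmodule ↔ 0 ≤ b.partialHeight J φ := by
  rw [h𝔮, rootLine_le_cartan_sup_rootSum_iff]; rfl

/-- The sum of the root spaces of positive partial height, as an ideal of the parabolic
subalgebra. -/
def positiveIdeal : LieIdeal ℂ 𝔮 where
  __ := (rootSum {φ : H.root | 1 ≤ b.partialHeight J φ}).comap 𝔮.toSubmodule.subtype
  lie_mem {x y} hy := by
    have hx : (x : 𝔤) ∈ H.toSubmodule ⊔ rootSum {φ : H.root | 0 ≤ b.partialHeight J φ} :=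
      h𝔮 ▸ x.2
    obtain ⟨h, hh, z, hz, hsum⟩ := Submodule.mem_sup.1 hx
    change ⁅(x : 𝔤), (y : 𝔤)⁆ ∈ rootSum {φ : H.root | 1 ≤ b.partialHeight J φ}
    rw [← hsum, add_lie]
    refine add_mem (lie_mem_rootSum_of_mem_cartan hh hy) (lie_mem_rootSum
      (fun φ hφ ψ hψ ↦ b.root_ne_neg_of_partialHeight_add_pos J
        (by simp only [Set.mem_ofPred_eq] at hφ hψ; omega))
      (fun φ hφ ψ hψ χ hχ ↦ ?_) hz hy)
    simp only [Set.mem_ofPred_eq] at hφ hψ ⊢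
    rw [b.partialHeight_add J hχ]
    omega

lemma isNilpotent_positiveIdeal : LieRing.IsNilpotent (positiveIdeal b J h𝔮) := by
  have := isNilpotent_of_toSubmodule_eq_rootSum b J (𝔫 := positivePart b J) rfl
  let f : positiveIdeal b J h𝔮 →ₗ⁅ℂ⁆ positivePart b J :=
    { toFun := fun x ↦ ⟨((x : 𝔮) : 𝔤), x.2⟩
      map_add' := fun _ _ ↦ rfl
      map_smul' := fun _ _ ↦ rfl
      map_lie' := rfl }
  refine Function.Injective.lieAlgebra_isNilpotent (f := f) fun x y hxy ↦ ?_
  exact Subtype.ext (Subtype.ext (congrArg (fun z : positivePart b J ↦ (z : 𝔤)) hxy))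

/-- A nilpotent ideal meets 𝔥 trivially, so it is a sum of root spaces. It contains none of partial
height zero, because 𝔮 would contain the opposite root space too and the coroot would lie in the
ideal. -/
lemma le_positiveIdeal {I : LieIdeal ℂ 𝔮} (hI : LieRing.IsNilpotent I) :
    I ≤ positiveIdeal b J h𝔮 := by
  have hH := cartan_le_parabolic b J h𝔮
  -- If h ≠ 0, some root φ of 𝔮 has φ(h) ≠ 0 (replace φ by -φ if needed). Then e_φ lies in the ideal
  -- and is an eigenvector of ad h with nonzero eigenvalue.
  have hcart {h : 𝔮} (hhI : h ∈ I) (hh : (h : 𝔤) ∈ H) : h = 0 := by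
    by_contra hne
    have hne' : (⟨h, hh⟩ : H) ≠ 0 := fun h' ↦ hne (Subtype.ext (congrArg (fun z : H ↦ (z : 𝔤)) h'))
    obtain ⟨φ, hφ, hφ0⟩ : ∃ φ : H.root, (rootSystem H).root φ ⟨h, hh⟩ ≠ 0 ∧
        0 ≤ b.partialHeight J φ := by
      obtain ⟨φ, hφ⟩ := exists_root_apply_ne_zero hne'
      obtain ⟨k, hk⟩ := (rootSystem H).exists_root_eq_neg φ
      rcases b.isPos_or_isPos_of_root_eq_neg hk with h' | h'
      · exact ⟨φ, hφ, h'.partialHeight_nonneg J⟩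
      · exact ⟨k, by rwa [hk, LinearMap.neg_apply, neg_ne_zero], h'.partialHeight_nonneg J⟩
    obtain ⟨e, he, he0⟩ := exists_ne_zero_mem_rootLine φ
    have heq : e ∈ 𝔮 := (rootLine_le_parabolic_iff b J h𝔮).2 hφ0 he
    have hlie : ⁅h, (⟨e, heq⟩ : 𝔮)⁆ = (rootSystem H).root φ ⟨h, hh⟩ • (⟨e, heq⟩ : 𝔮) :=
      Subtype.ext (lie_eq_smul_of_mem_rootLine he ⟨h, hh⟩)
    have heI : (⟨e, heq⟩ : 𝔮) ∈ I := by
      have := I.smul_mem ((rootSystem H).root φ ⟨h, hh⟩)⁻¹ (lie_mem_left ℂ 𝔮 I h ⟨e, heq⟩ hhI)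
      rwa [hlie, smul_smul, inv_mul_cancel₀ hφ, one_smul] at this
    have := eq_zero_of_lie_eq_smul (L := I) (x := ⟨h, hhI⟩) (y := ⟨⟨e, heq⟩, heI⟩) hφ
      (Subtype.ext hlie)
    exact he0 (congrArg (fun z : I ↦ ((z : 𝔮) : 𝔤)) this)
  set U : Submodule ℂ 𝔤 := I.toSubmodule.map 𝔮.toSubmodule.subtype with hUdef
  have hU : U = rootSum {φ : H.root | rootLine φ ≤ U} := by
    refine eq_rootSum_of_disjoint ?_ (Submodule.disjoint_def.2 ?_)
    · rintro h hh _ ⟨x, hx, rfl⟩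
      exact ⟨⁅(⟨h, hH hh⟩ : 𝔮), x⁆, lie_mem_right ℂ 𝔮 I _ _ hx, rfl⟩
    · rintro _ ⟨x, hx, rfl⟩ hxH
      rw [hcart hx hxH]
      rfl
  suffices h : U ≤ rootSum {φ : H.root | 1 ≤ b.partialHeight J φ} from
    fun x hx ↦ h ⟨x, hx, rfl⟩
  rw [hU]
  refine rootSum_mono fun φ (hφ : rootLine φ ≤ U) ↦ ?_
  have hU𝔮 : U ≤ 𝔮.toSubmodule := by
    rintro _ ⟨x, -, rfl⟩
    exact x.2
  have hφ0 := (rootLine_le_parabolic_iff b J h𝔮).1 (hφ.trans hU𝔮)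
  by_contra hφ1
  simp only [Set.mem_ofPred_eq] at hφ1
  obtain ⟨k, hk⟩ := (rootSystem H).exists_root_eq_neg φ
  obtain ⟨h, e, f, ht, he, hf⟩ := exists_isSl2Triple_of_weight_isNonZero
    (H.isNonZero_coe_root φ)
  have hfk : f ∈ rootLine k := by
    have : (k.1 : H → ℂ) = -(φ.1 : H → ℂ) := funext fun x ↦ LinearMap.congr_fun hk x
    change f ∈ rootSpace H (k.1 : H → ℂ)
    rwa [this]
  have hf𝔮 : f ∈ 𝔮 := (rootLine_le_parabolic_iff b J h𝔮).2
    (by rw [b.partialHeight_neg J hk]; omega) hfk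
  obtain ⟨e', he', rfl⟩ : ∃ e' : 𝔮, e' ∈ I ∧ (e' : 𝔤) = e := hφ he
  have hhI : ⁅e', (⟨f, hf𝔮⟩ : 𝔮)⁆ ∈ I := lie_mem_left ℂ 𝔮 I _ _ he'
  have hcoe : ((⁅e', (⟨f, hf𝔮⟩ : 𝔮)⁆ : 𝔮) : 𝔤) = h := ht.lie_e_f
  have hhH : h ∈ H := by
    rw [ht.h_eq_coroot (H.isNonZero_coe_root φ) he hf]
    exact (coroot _).2
  have h0 := hcart hhI (hcoe ▸ hhH)
  rw [h0] at hcoe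
  exact ht.h_ne_zero hcoe.symm

/-- The nilradical of a standard parabolic subalgebra is the sum of the root spaces of positive
partial height. -/
theorem nil_toSubmodule :
    (nil 𝔮).toSubmodule = rootSum {φ : H.root | 1 ≤ b.partialHeight J φ} := by
  have h : nilradical 𝔮 = positiveIdeal b J h𝔮 :=
    le_antisymm (sSup_le fun I hI ↦ le_positiveIdeal b J h𝔮 hI)
      (le_sSup (isNilpotent_positiveIdeal b J h𝔮))
  ext x
  constructor
  · rintro ⟨y, hy, rfl⟩
    have hy' : y ∈ nilradical 𝔮 := hy
    rw [h] at hy'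
    exact hy'
  · intro hx
    have hx𝔮 : x ∈ 𝔮.toSubmodule := rootSum_le_iff.2 (fun φ hφ ↦
      (rootLine_le_parabolic_iff b J h𝔮).2 (by simp only [Set.mem_ofPred_eq] at hφ; omega)) hx
    refine ⟨⟨x, hx𝔮⟩, ?_, rfl⟩
    change (⟨x, hx𝔮⟩ : 𝔮) ∈ nilradical 𝔮
    rw [h]
    exact hx

variable {𝔪 : LieSubalgebra ℂ 𝔤} (h𝔪 : IsLeviFactor 𝔮 𝔪) (hH : H ≤ 𝔪)
include h𝔪 hH

lemma rootLine_le_levi_iff {φ : H.root} :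
    rootLine φ ≤ 𝔪.toSubmodule ↔ b.partialHeight J φ = 0 := by
  have hn := nil_toSubmodule b J h𝔮
  have hdec := eq_cartan_sup_rootSum (U := 𝔪.toSubmodule)
    (fun h hh x hx ↦ 𝔪.lie_mem (hH hh) hx) hH
  constructor
  · intro hφ
    have h0 := (rootLine_le_parabolic_iff b J h𝔮).1
      (hφ.trans (le_sup_left.trans h𝔪.sup_eq.le))
    by_contra hne
    obtain ⟨x, hx, hx0⟩ := exists_ne_zero_mem_rootLine φ
    refine hx0 (Submodule.disjoint_def.1 h𝔪.disjoint x (hφ hx) ?_)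
    rw [hn]
    exact rootLine_le_rootSum (s := {φ : H.root | 1 ≤ b.partialHeight J φ})
      (by simp only [Set.mem_ofPred_eq]; omega) hx
  · intro hφ
    -- The root space lies in 𝔮 = 𝔪 + 𝔫. By independence of root spaces φ is a root of 𝔪 or of 𝔫,
    -- and partial height zero excludes the latter.
    have hle : rootLine φ ≤ H.toSubmodule ⊔
        rootSum ({φ : H.root | rootLine φ ≤ 𝔪.toSubmodule} ∪
          {φ : H.root | 1 ≤ b.partialHeight J φ}) := by
      refine ((rootLine_le_parabolic_iff b J h𝔮).2 hφ.ge).trans ?_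
      rw [← h𝔪.sup_eq, hn]
      refine sup_le (hdec.le.trans (sup_le_sup_left (rootSum_mono ?_) _))
        (le_sup_of_le_right (rootSum_mono ?_))
      · exact Set.subset_union_left
      · exact Set.subset_union_right
    rcases rootLine_le_cartan_sup_rootSum_iff.1 hle with h | h
    · exact h
    · simp only [Set.mem_ofPred_eq] at h
      omega

/-- The Levi factor containing the Cartan subalgebra is the sum of the latter and of the root
spaces of partial height zero. -/
theorem levi_toSubmodule :
    𝔪.toSubmodule = H.toSubmodule ⊔ rootSum {φ : H.root | b.partialHeight J φ = 0} := by
  have h := eq_cartan_sup_rootSum (U := 𝔪.toSubmodule)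
    (fun h hh x hx ↦ 𝔪.lie_mem (hH hh) hx) hH
  simpa only [rootLine_le_levi_iff b J h𝔮 h𝔪 hH] using h

lemma outerSimple_eq : outerSimple b 𝔪 = J := by
  classical
  ext α
  rw [outerSimple, Finset.mem_filter, rootLine_le_levi_iff b J h𝔮 h𝔪 hH]
  by_cases hα : α ∈ J
  · simp [hα, b.partialHeight_simple_of_mem J hα]
  · simp [hα, b.partialHeight_simple_of_notMem J hα]

end Nilradical

/-- A standard parabolic subalgebra is determined by a set of simple roots. -/
theorem exists_toSubmodule_eq_of_borel_le {𝔮 : LieSubalgebra ℂ 𝔤}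
    (hb : borel b ≤ 𝔮.toSubmodule) : ∃ J : Finset b.support,
      𝔮.toSubmodule = H.toSubmodule ⊔ rootSum {φ : H.root | 0 ≤ b.partialHeight J φ} := by
  classical
  have hH : H.toSubmodule ≤ 𝔮.toSubmodule := le_sup_left.trans hb
  have hpos (φ : H.root) (hφ : b.IsPos φ) : rootLine φ ≤ 𝔮.toSubmodule :=
    (le_iSup₂_of_le φ hφ le_rfl).trans (le_sup_right.trans hb)
  let J : Finset b.support := Finset.univ.filter fun α ↦ ∃ k : H.root,
    (rootSystem H).root k = -(rootSystem H).root α ∧ ¬ rootLine k ≤ 𝔮.toSubmodule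
  have hJ (α : b.support) (k : H.root)
      (hk : (rootSystem H).root k = -(rootSystem H).root (α : H.root)) :
      α ∈ J ↔ k ∉ {φ : H.root | rootLine φ ≤ 𝔮.toSubmodule} := by
    simp only [J, Finset.mem_filter, Finset.mem_univ, true_and, Set.mem_ofPred_eq]
    refine ⟨fun ⟨l, hl, h⟩ ↦ ?_, fun h ↦ ⟨k, hk, h⟩⟩
    rwa [(rootSystem H).root.injective (hk.trans hl.symm)]
  have hadd : ∀ φ ∈ {φ : H.root | rootLine φ ≤ 𝔮.toSubmodule},
      ∀ ψ ∈ {φ : H.root | rootLine φ ≤ 𝔮.toSubmodule}, ∀ χ,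
        (rootSystem H).root χ = (rootSystem H).root φ + (rootSystem H).root ψ →
          χ ∈ {φ : H.root | rootLine φ ≤ 𝔮.toSubmodule} := by
    intro φ hφ ψ hψ χ hχ
    obtain ⟨x, hx, hx0⟩ := exists_ne_zero_mem_rootLine φ
    obtain ⟨y, hy, hy0⟩ := exists_ne_zero_mem_rootLine ψ
    exact rootLine_le_of_mem (lie_mem_rootLine hχ hx hy)
      (lie_ne_zero_of_root_add hχ hx hx0 hy hy0) (𝔮.lie_mem (hφ hx) (hψ hy))
  refine ⟨J, ?_⟩
  have h := eq_cartan_sup_rootSum (U := 𝔮.toSubmodule)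
    (fun h hh x hx ↦ 𝔮.lie_mem (hH hh) hx) hH
  have hset : {φ : H.root | rootLine φ ≤ 𝔮.toSubmodule} =
      {φ : H.root | 0 ≤ b.partialHeight J φ} :=
    Set.ext fun φ ↦ b.mem_parabolic_iff hpos hadd hJ φ
  rwa [hset] at h

end LeviRoots

end

noncomputable section

namespace LeviRoots

variable {𝔤 : Type*} [LieRing 𝔤] [LieAlgebra ℂ 𝔤] [FiniteDimensional ℂ 𝔤]
  [LieAlgebra.IsSimple ℂ 𝔤] {H : LieSubalgebra ℂ 𝔤} [H.IsCartanSubalgebra]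
  (b : (rootSystem H).Base) (J : Finset b.support)

lemma sum_rootCoeff_smul_root (φ : H.root) :
    ∑ α, b.rootCoeff φ α • (rootSystem H).root (α : H.root) = (rootSystem H).root φ := by
  have h := congrArg ((rootSystem H).rootSpan ℤ).subtype (b.sum_rootCoeff_smul φ)
  rw [map_sum] at h
  exact h

/-- The fundamental coweights. -/
lemma exists_root_apply_eq_rootCoeff (α : b.support) :
    ∃ h : H, ∀ φ : H.root, (rootSystem H).root φ h = (b.rootCoeff φ α : ℂ) := by
  refine ⟨(evalEquiv ℂ H).symm (b.toWeightBasis.coord α), fun φ ↦ ?_⟩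
  have h (f : Dual ℂ H) : f ((evalEquiv ℂ H).symm (b.toWeightBasis.coord α)) =
      b.toWeightBasis.coord α f := by
    simp
  rw [h, ← sum_rootCoeff_smul_root b φ, map_sum, Finset.sum_eq_single α]
  · have : (rootSystem H).root (α : H.root) = b.toWeightBasis α := by simp
    rw [this, map_zsmul, Basis.coord_apply, Basis.repr_self, Finsupp.single_eq_same]
    simp
  · intro β _ hβ
    have : (rootSystem H).root (β : H.root) = b.toWeightBasis β := by simp
    rw [this, map_zsmul, Basis.coord_apply, Basis.repr_self, Finsupp.single_eq_of_ne (Ne.symm hβ),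
      smul_zero]
  · simp

/-! ### The center of the Levi factor, its roots and the grading. -/

section CenterRoots

variable {𝔪 : LieSubalgebra ℂ 𝔤}
  (h𝔪 : 𝔪.toSubmodule = H.toSubmodule ⊔ rootSum {φ : H.root | b.partialHeight J φ = 0})
  (hH : H ≤ 𝔪)
include h𝔪

/-- Supplies enough elements of 𝔱: it shows that the fundamental coweights of the simple roots in
`J` are central in 𝔪. -/
lemma exists_centIncl_eq {h : H}
    (hh : ∀ φ : H.root, b.partialHeight J φ = 0 → (rootSystem H).root φ h = 0) :
    ∃ x : cent 𝔪, centIncl hH x = h := by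
  have hmem : (⟨h, hH h.2⟩ : 𝔪) ∈ cent 𝔪 := by
    refine (LieModule.mem_maxTrivSubmodule (R := ℂ) (L := 𝔪) (M := 𝔪) _).2 fun y ↦
      Subtype.ext ?_
    have hy : (y : 𝔤) ∈ H.toSubmodule ⊔ rootSum {φ : H.root | b.partialHeight J φ = 0} :=
      h𝔪 ▸ y.2
    have hle : H.toSubmodule ⊔ rootSum {φ : H.root | b.partialHeight J φ = 0} ≤
        LinearMap.ker (LieModule.toEnd ℂ 𝔤 𝔤 (h : 𝔤)) := by
      refine sup_le (fun z hz ↦ ?_) (rootSum_le_iff.2 fun φ hφ z hz ↦ ?_)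
      · exact congrArg (fun z : H ↦ (z : 𝔤)) (trivial_lie_zero H H h ⟨z, hz⟩)
      · rw [LinearMap.mem_ker, LieModule.toEnd_apply_apply, lie_eq_smul_of_mem_rootLine hz,
          hh φ hφ, zero_smul]
    have h0 : ⁅(h : 𝔤), (y : 𝔤)⁆ = 0 := hle hy
    change ⁅(y : 𝔤), (h : 𝔤)⁆ = 0
    rw [← lie_skew, h0, neg_zero]
  exact ⟨⟨_, hmem⟩, rfl⟩

lemma root_apply_centIncl_eq_zero {φ : H.root} (hφ : b.partialHeight J φ = 0) (x : cent 𝔪) :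
    (rootSystem H).root φ (centIncl hH x) = 0 := by
  obtain ⟨e, he, he0⟩ := exists_ne_zero_mem_rootLine φ
  have he𝔪 : e ∈ 𝔪.toSubmodule := by
    rw [h𝔪]
    exact rootLine_le_cartan_sup_rootSum_iff.2
      (show φ ∈ {φ : H.root | b.partialHeight J φ = 0} from hφ) he
  have h := (LieModule.mem_maxTrivSubmodule (R := ℂ) (L := 𝔪) (M := 𝔪) (x : 𝔪)).1 x.2 ⟨e, he𝔪⟩
  have h' : ⁅e, ((x : 𝔪) : 𝔤)⁆ = 0 := congrArg (fun z : 𝔪 ↦ (z : 𝔤)) h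
  have h'' := lie_eq_smul_of_mem_rootLine he (centIncl hH x)
  change ⁅((x : 𝔪) : 𝔤), e⁆ = _ at h''
  rw [← lie_skew, h', neg_zero] at h''
  exact (smul_eq_zero.1 h''.symm).resolve_right he0

lemma exists_root_apply_centIncl_eq_rootCoeff {α : b.support} (hα : α ∈ J) :
    ∃ x : cent 𝔪, ∀ φ : H.root,
      (rootSystem H).root φ (centIncl hH x) = (b.rootCoeff φ α : ℂ) := by
  obtain ⟨h, hh⟩ := exists_root_apply_eq_rootCoeff b α
  obtain ⟨x, rfl⟩ := exists_centIncl_eq b J h𝔪 hH (h := h) fun φ hφ ↦ by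
    rw [hh, (b.partialHeight_eq_zero_iff J).1 hφ α hα, Int.cast_zero]
  exact ⟨x, hh⟩

/-- Coefficients at `J` are values at fundamental coweights lying in 𝔱; conversely they determine
the restriction, since the other simple roots vanish on 𝔱. -/
lemma restrict_root_eq_iff {φ ψ : H.root} :
    restrict hH ((rootSystem H).root φ) = restrict hH ((rootSystem H).root ψ) ↔
      ∀ α ∈ J, b.rootCoeff φ α = b.rootCoeff ψ α := by
  constructor
  · intro h α hα
    obtain ⟨x, hx⟩ := exists_root_apply_centIncl_eq_rootCoeff b J h𝔪 hH hα
    have := LinearMap.congr_fun h x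
    change (rootSystem H).root φ (centIncl hH x) = (rootSystem H).root ψ (centIncl hH x) at this
    rw [hx, hx] at this
    exact_mod_cast this
  · intro h
    refine LinearMap.ext fun x ↦ ?_
    change (rootSystem H).root φ (centIncl hH x) = (rootSystem H).root ψ (centIncl hH x)
    rw [← sum_rootCoeff_smul_root b φ, ← sum_rootCoeff_smul_root b ψ, LinearMap.sum_apply,
      LinearMap.sum_apply]
    refine Finset.sum_congr rfl fun α _ ↦ ?_
    rw [LinearMap.smul_apply, LinearMap.smul_apply]
    by_cases hα : α ∈ J
    · rw [h α hα]
    · rw [root_apply_centIncl_eq_zero b J h𝔪 hH (b.partialHeight_simple_of_notMem J hα),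
        smul_zero, smul_zero]

lemma restrict_root_ne_zero {φ : H.root} (hφ : b.partialHeight J φ ≠ 0) :
    restrict hH ((rootSystem H).root φ) ≠ 0 := by
  intro h0
  refine hφ ((b.partialHeight_eq_zero_iff J).2 fun α hα ↦ ?_)
  obtain ⟨x, hx⟩ := exists_root_apply_centIncl_eq_rootCoeff b J h𝔪 hH hα
  have := LinearMap.congr_fun h0 x
  change (rootSystem H).root φ (centIncl hH x) = 0 at this
  rw [hx] at this
  exact_mod_cast this

omit h𝔪 in
lemma rootLine_le_tSpace_iff {φ : H.root} {ν : Dual ℂ (cent 𝔪)} :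
    rootLine φ ≤ tSpace 𝔪 ν ↔ restrict hH ((rootSystem H).root φ) = ν := by
  constructor
  · intro h
    obtain ⟨e, he, he0⟩ := exists_ne_zero_mem_rootLine φ
    refine LinearMap.ext fun x ↦ smul_left_injective ℂ he0 ?_
    exact (lie_eq_smul_of_mem_rootLine he (centIncl hH x)).symm.trans (h he x)
  · rintro rfl e he x
    exact lie_eq_smul_of_mem_rootLine he (centIncl hH x)

-- 𝔱 acts by zero on 𝔥, so for ν ≠ 0 the 𝔥-stable space 𝔤_ν meets 𝔥 trivially and is a sum of root
-- spaces.
omit h𝔪 in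
lemma tSpace_eq_rootSum {ν : Dual ℂ (cent 𝔪)} (hν : ν ≠ 0) :
    tSpace 𝔪 ν = rootSum {φ : H.root | restrict hH ((rootSystem H).root φ) = ν} := by
  have hcomm (x : cent 𝔪) {h : 𝔤} (hh : h ∈ H) : ⁅((x : 𝔪) : 𝔤), h⁆ = 0 :=
    congrArg (fun z : H ↦ (z : 𝔤)) (trivial_lie_zero H H (centIncl hH x) ⟨h, hh⟩)
  have h := eq_rootSum_of_disjoint (H := H) (U := tSpace 𝔪 ν) (fun h hh z hz x ↦ by
      rw [leibniz_lie, hcomm x hh, zero_lie, zero_add, hz x, lie_smul])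
    (Submodule.disjoint_def.2 fun z hz hzH ↦ by
      obtain ⟨x, hx⟩ : ∃ x, ν x ≠ 0 := by
        by_contra! hcon
        exact hν (LinearMap.ext hcon)
      have := hz x
      rw [hcomm x hzH] at this
      exact (smul_eq_zero.1 this.symm).resolve_left hx)
  simpa only [rootLine_le_tSpace_iff hH] using h

omit h𝔪 in
lemma isTRoot_iff {ν : Dual ℂ (cent 𝔪)} : IsTRoot 𝔪 ν ↔
    ν ≠ 0 ∧ ∃ φ : H.root, restrict hH ((rootSystem H).root φ) = ν := by
  refine and_congr_right fun hν ↦ ?_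
  rw [tSpace_eq_rootSum hH hν, ← rootSum_empty (H := H), rootSum_injective.ne_iff,
    ← Set.nonempty_iff_ne_empty]
  rfl

lemma isTRoot_restrict {φ : H.root} (hφ : b.partialHeight J φ ≠ 0) :
    IsTRoot 𝔪 (restrict hH ((rootSystem H).root φ)) :=
  (isTRoot_iff hH).2 ⟨restrict_root_ne_zero b J h𝔪 hH hφ, φ, rfl⟩

lemma tSpace_restrict {φ : H.root} (hφ : b.partialHeight J φ ≠ 0) :
    tSpace 𝔪 (restrict hH ((rootSystem H).root φ)) =
      rootSum {χ : H.root | ∀ α ∈ J, b.rootCoeff χ α = b.rootCoeff φ α} := by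
  simp only [tSpace_eq_rootSum hH (restrict_root_ne_zero b J h𝔪 hH hφ),
    restrict_root_eq_iff b J h𝔪 hH]

variable (hJ : outerSimple b 𝔪 = J)
include hJ

lemma tHeight_restrict (φ : H.root) :
    tHeight b 𝔪 (restrict hH ((rootSystem H).root φ)) = b.partialHeight J φ := by
  have hex : ∃ χ : H.root, rootLine χ ≤ tSpace 𝔪 (restrict hH ((rootSystem H).root φ)) :=
    ⟨φ, (rootLine_le_tSpace_iff hH).2 rfl⟩
  rw [tHeight, hJ]
  refine Finset.sum_congr rfl fun α hα ↦ ?_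
  -- The chosen root may differ from φ, but it has the same restriction to 𝔱, hence the same
  -- coefficients at `J`.
  rw [tCoeff, dif_pos hex]
  exact (restrict_root_eq_iff b J h𝔪 hH).1 ((rootLine_le_tSpace_iff hH).1 hex.choose_spec) α hα

lemma graded_eq_rootSum {k : ℕ} (hk : 1 ≤ k) :
    graded b 𝔪 k = rootSum {φ : H.root | b.partialHeight J φ = k} := by
  have hH' : H ≤ 𝔪 := by
    rw [← LieSubalgebra.toSubmodule_le_toSubmodule, h𝔪]
    exact le_sup_left
  refine le_antisymm (iSup_le fun ν ↦ iSup₂_le fun hν hνk ↦ ?_)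
    (rootSum_le_iff.2 fun φ hφ ↦ ?_)
  · rw [tSpace_eq_rootSum hH' hν.1]
    refine rootSum_mono ?_
    rintro φ rfl
    rwa [tHeight_restrict b J h𝔪 hH' hJ] at hνk
  · simp only [Set.mem_ofPred_eq] at hφ
    refine le_trans ?_ (le_iSup_of_le (restrict hH' ((rootSystem H).root φ))
      (le_iSup₂_of_le (isTRoot_restrict b J h𝔪 hH' (by omega)) ?_ le_rfl))
    · exact (rootLine_le_tSpace_iff hH').2 rfl
    · rw [tHeight_restrict b J h𝔪 hH' hJ, hφ]

lemma exists_bracket_tSpace_eq {i : ℕ} (hi : 2 ≤ i) {ν : Dual ℂ (cent 𝔪)} (hν : IsTRoot 𝔪 ν)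
    (hνi : tSpace 𝔪 ν ≤ graded b 𝔪 i) :
    ∃ α ∈ J, ∃ μ : Dual ℂ (cent 𝔪), IsTRoot 𝔪 μ ∧ tSpace 𝔪 μ ≤ graded b 𝔪 (i - 1) ∧
      bracket (tSpace 𝔪 (simpleTRoot b hH α)) (tSpace 𝔪 μ) = tSpace 𝔪 ν := by
  obtain ⟨-, γ, rfl⟩ := (isTRoot_iff hH).1 hν
  have hγ : b.partialHeight J γ = i := by
    rw [graded_eq_rootSum b J h𝔪 hJ (by omega)] at hνi
    exact rootLine_le_rootSum_iff.1 (((rootLine_le_tSpace_iff hH).2 rfl).trans hνi)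
  obtain ⟨α, hα, μ, hsum, hdec⟩ := b.exists_forall_root_eq_add J (γ := γ) (by omega)
  have hα1 := b.partialHeight_simple_of_mem J hα
  have hμ : b.partialHeight J μ = ((i - 1 : ℕ) : ℤ) := by
    have : b.partialHeight J γ = b.partialHeight J α + b.partialHeight J μ := by
      simp only [RootPairing.Base.partialHeight, ← Finset.sum_add_distrib]
      exact Finset.sum_congr rfl hsum
    omega
  have hμ0 : b.partialHeight J μ ≠ 0 := by omega
  refine ⟨α, hα, _, isTRoot_restrict b J h𝔪 hH hμ0, ?_, ?_⟩
  · rw [tSpace_restrict b J h𝔪 hH hμ0, graded_eq_rootSum b J h𝔪 hJ (by omega)]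
    exact rootSum_mono fun χ hχ ↦ (b.partialHeight_congr J hχ).trans hμ
  · rw [simpleTRoot, tSpace_restrict b J h𝔪 hH (by omega), tSpace_restrict b J h𝔪 hH hμ0,
      tSpace_restrict b J h𝔪 hH (by omega), bracket_rootSum fun φ hφ ψ hψ ↦
        b.root_ne_neg_of_partialHeight_add_pos J (by
          rw [b.partialHeight_congr J hφ, b.partialHeight_congr J hψ]
          omega)]
    congr 1
    ext χ
    constructor
    · rintro ⟨φ, hφ, ψ, hψ, hχ⟩ a ha
      rw [b.rootCoeff_add hχ, hφ a ha, hψ a ha, hsum a ha]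
    · intro hχ
      obtain ⟨φ, ψ, hφ, hψ, h⟩ := hdec χ hχ
      exact ⟨φ, hφ, ψ, hψ, h⟩

lemma bracket_graded_one {i : ℕ} (hi : 2 ≤ i) :
    bracket (graded b 𝔪 1) (graded b 𝔪 (i - 1)) = graded b 𝔪 i := by
  rw [graded_eq_rootSum b J h𝔪 hJ le_rfl, graded_eq_rootSum b J h𝔪 hJ (k := i - 1) (by omega),
    graded_eq_rootSum b J h𝔪 hJ (k := i) (by omega), bracket_rootSum fun φ hφ ψ hψ ↦
      b.root_ne_neg_of_partialHeight_add_pos J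
        (by simp only [Set.mem_ofPred_eq] at hφ hψ; omega)]
  congr 1
  ext χ
  simp only [Set.mem_ofPred_eq]
  constructor
  · rintro ⟨φ, hφ, ψ, hψ, h⟩
    rw [b.partialHeight_add J h]
    omega
  · intro hχ
    obtain ⟨α, hα, μ, -, h⟩ := b.exists_forall_root_eq_add J (γ := χ) (by omega)
    obtain ⟨φ, ψ, hφ, -, hχ'⟩ := h χ fun _ _ ↦ rfl
    have h1 := b.partialHeight_congr J hφ
    rw [b.partialHeight_simple_of_mem J hα] at h1
    have h2 := b.partialHeight_add J hχ'
    exact ⟨φ, by omega, ψ, by omega, hχ'⟩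

lemma iSup_graded {i k : ℕ} (hi : 1 ≤ i) (hk : ∀ φ : H.root, b.partialHeight J φ ≤ k) :
    ⨆ j ∈ Finset.Icc i k, graded b 𝔪 j = rootSum {φ : H.root | (i : ℤ) ≤ b.partialHeight J φ} := by
  refine le_antisymm (iSup₂_le fun j hj ↦ ?_) (rootSum_le_iff.2 fun φ hφ ↦ ?_)
  · rw [Finset.mem_Icc] at hj
    rw [graded_eq_rootSum b J h𝔪 hJ (by omega)]
    refine rootSum_mono fun φ hφ ↦ ?_
    simp only [Set.mem_ofPred_eq] at hφ ⊢
    omega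
  · simp only [Set.mem_ofPred_eq] at hφ
    have hφk := hk φ
    refine le_iSup₂_of_le (b.partialHeight J φ).toNat (Finset.mem_Icc.2 (by omega)) ?_
    rw [graded_eq_rootSum b J h𝔪 hJ (by omega)]
    refine rootLine_le_rootSum ?_
    simp only [Set.mem_ofPred_eq]
    omega

end CenterRoots

/-! ### The upper central series as a filtration by partial height. -/

section UpperSeries

variable {𝔫 : LieSubalgebra ℂ 𝔤}
  (h𝔫 : 𝔫.toSubmodule = rootSum {φ : H.root | 1 ≤ b.partialHeight J φ})
  {ψ : H.root} (hψ : IsHighestRoot b ψ)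
include h𝔫 hψ

/-- Bracketing with 𝔫 raises partial height by at least one, and by exactly one for a suitable root
vector as long as the height is below that of ψ. So each step of the series lowers the threshold by
exactly one. -/
lemma map_upperSeries_eq_rootSum (d : ℕ) :
    (upperSeries 𝔫 d).toSubmodule.map 𝔫.toSubmodule.subtype =
      rootSum {φ : H.root | 1 ≤ b.partialHeight J φ ∧
        b.partialHeight J ψ + 1 ≤ b.partialHeight J φ + d} := by
  have hmax := b.partialHeight_le_of_maximal hψ J
  induction d with
  | zero =>
    rw [upperSeries, LieSubmodule.ucs_zero, LieSubmodule.bot_toSubmodule, Submodule.map_bot,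
      ← rootSum_empty (H := H)]
    congr 1
    refine (Set.eq_empty_iff_forall_notMem.2 fun φ ↦ ?_).symm
    have := hmax φ
    simp only [Set.mem_ofPred_eq]
    push_cast
    omega
  | succ d ih =>
    set N := upperSeries 𝔫 d with hN
    have hmemN (x : 𝔫) : x ∈ N ↔ (x : 𝔤) ∈ rootSum {φ : H.root | 1 ≤ b.partialHeight J φ ∧
        b.partialHeight J ψ + 1 ≤ b.partialHeight J φ + d} := by
      rw [← ih]
      exact ⟨fun h ↦ ⟨x, h, rfl⟩, fun ⟨y, hy, h⟩ ↦ (Subtype.ext h : y = x) ▸ hy⟩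
    have hmem (x : 𝔫) : x ∈ upperSeries 𝔫 (d + 1) ↔ ∀ y : 𝔫, ⁅y, x⁆ ∈ N := by
      rw [upperSeries, LieSubmodule.ucs_succ, LieSubmodule.mem_normalizer]
      rfl
    have h𝔫H (h : 𝔤) (hh : h ∈ H) (x : 𝔤) (hx : x ∈ 𝔫) : ⁅h, x⁆ ∈ 𝔫 := by
      change ⁅h, x⁆ ∈ 𝔫.toSubmodule
      rw [h𝔫]
      exact lie_mem_rootSum_of_mem_cartan hh (h𝔫 ▸ hx)
    have hU := eq_rootSum_of_disjoint (H := H)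
      (U := (upperSeries 𝔫 (d + 1)).toSubmodule.map 𝔫.toSubmodule.subtype)
      (by
        rintro h hh _ ⟨x, hx, rfl⟩
        refine ⟨⟨⁅h, (x : 𝔤)⁆, h𝔫H h hh x x.2⟩, (hmem _).2 fun y ↦ (hmemN _).2 ?_, rfl⟩
        have h1 := (hmemN _).1 ((hmem x).1 hx y)
        have h2 := (hmemN _).1 ((hmem x).1 hx ⟨⁅h, (y : 𝔤)⁆, h𝔫H h hh y y.2⟩)
        change ⁅(y : 𝔤), ⁅h, (x : 𝔤)⁆⁆ ∈ _
        -- The next term inherits stability under 𝔥 from `N` and 𝔫 because ad h is a derivation.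
        have h3 : ⁅(y : 𝔤), ⁅h, (x : 𝔤)⁆⁆ = ⁅h, ⁅(y : 𝔤), (x : 𝔤)⁆⁆ - ⁅⁅h, (y : 𝔤)⁆, (x : 𝔤)⁆ := by
          rw [leibniz_lie h]
          abel
        rw [h3]
        exact Submodule.sub_mem _ (lie_mem_rootSum_of_mem_cartan hh h1) h2)
      ((disjoint_cartan_rootSum {φ : H.root | 1 ≤ b.partialHeight J φ}).symm.mono_left (by
        rintro _ ⟨x, -, rfl⟩
        exact h𝔫 ▸ x.2))
    rw [hU]
    congr 1
    ext φ
    simp only [Set.mem_ofPred_eq]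
    push_cast
    constructor
    · intro hφ
      have hφ1 : 1 ≤ b.partialHeight J φ := by
        refine (rootLine_le_rootSum_iff (s := {φ : H.root | 1 ≤ b.partialHeight J φ})).1
          (hφ.trans ?_)
        rintro _ ⟨x, -, rfl⟩
        exact h𝔫 ▸ x.2
      refine ⟨hφ1, ?_⟩
      by_contra hlt
      -- Below the threshold φ is not of maximal partial height; raising it by only one gives a
      -- nonzero bracket that still misses `N`.
      obtain ⟨δ, χ, hδ, hχ⟩ := b.exists_partialHeight_eq_one_root_add hψ J (γ := φ)
        (by omega) (by omega)
      obtain ⟨x, hx, hx0⟩ := exists_ne_zero_mem_rootLine δ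
      obtain ⟨y, hy, hy0⟩ := exists_ne_zero_mem_rootLine φ
      obtain ⟨y', hy', hyy⟩ : ∃ y' : 𝔫, y' ∈ upperSeries 𝔫 (d + 1) ∧ (y' : 𝔤) = y := hφ hy
      have hx𝔫 : x ∈ 𝔫.toSubmodule := h𝔫 ▸ rootLine_le_rootSum
        (s := {φ : H.root | 1 ≤ b.partialHeight J φ}) hδ.ge hx
      rw [add_comm] at hχ
      have hmem' := (hmemN _).1 ((hmem y').1 hy' ⟨x, hx𝔫⟩)
      change ⁅x, (y' : 𝔤)⁆ ∈ _ at hmem'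
      rw [hyy] at hmem'
      have := rootLine_le_rootSum_iff.1 (rootLine_le_of_mem (lie_mem_rootLine hχ hx hy)
        (lie_ne_zero_of_root_add hχ hx hx0 hy hy0) hmem')
      simp only [Set.mem_ofPred_eq, b.partialHeight_add J hχ] at this
      omega
    · rintro ⟨hφ1, hφ2⟩ x hx
      have hx𝔫 : x ∈ 𝔫.toSubmodule := h𝔫 ▸ rootLine_le_rootSum
        (s := {φ : H.root | 1 ≤ b.partialHeight J φ}) hφ1 hx
      refine ⟨⟨x, hx𝔫⟩, (hmem _).2 fun y ↦ (hmemN _).2 ?_, rfl⟩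
      change ⁅(y : 𝔤), x⁆ ∈ _
      have hy : (y : 𝔤) ∈ rootSum {φ : H.root | 1 ≤ b.partialHeight J φ} := h𝔫 ▸ y.2
      have hx' : x ∈ rootSum {φ : H.root | 1 ≤ b.partialHeight J φ ∧
          b.partialHeight J ψ + 1 ≤ b.partialHeight J φ + (d + 1)} :=
        rootLine_le_rootSum (s := {φ : H.root | 1 ≤ b.partialHeight J φ ∧
          b.partialHeight J ψ + 1 ≤ b.partialHeight J φ + (d + 1)}) ⟨hφ1, hφ2⟩ hx
      refine lie_mem_rootSum (fun α hα β hβ ↦ b.root_ne_neg_of_partialHeight_add_pos J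
          (by simp only [Set.mem_ofPred_eq] at hα hβ; omega))
        (fun α hα β hβ χ hχ ↦ ?_) hy hx'
      simp only [Set.mem_ofPred_eq] at hα hβ ⊢
      rw [b.partialHeight_add J hχ]
      omega

/-- A simple root in `J` has partial height one, the lowest in 𝔫, so it enters the series last. -/
lemma upperSeries_eq_top_iff (hJ : J.Nonempty) (d : ℕ) :
    upperSeries 𝔫 d = ⊤ ↔ b.partialHeight J ψ ≤ d := by
  have h := map_upperSeries_eq_rootSum b J h𝔫 hψ d
  rw [← LieSubmodule.toSubmodule_eq_top,
    ← (Submodule.map_injective_of_injective 𝔫.toSubmodule.injective_subtype).eq_iff, h,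
    Submodule.map_top, Submodule.range_subtype, h𝔫, rootSum_injective.eq_iff]
  constructor
  · intro h'
    obtain ⟨α, hα⟩ := hJ
    have h1 := b.partialHeight_simple_of_mem J hα
    have h2 : (α : H.root) ∈ {φ : H.root | 1 ≤ b.partialHeight J φ} := h1.ge
    rw [← h'] at h2
    simp only [Set.mem_ofPred_eq] at h2
    omega
  · intro h'
    ext φ
    simp only [Set.mem_ofPred_eq]
    omega

lemma lowerCentralSeries_eq_upperSeries {i d : ℕ} (h : b.partialHeight J ψ = i + d) :
    LieModule.lowerCentralSeries ℂ 𝔫 𝔫 i = upperSeries 𝔫 d := by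
  rw [← LieSubmodule.toSubmodule_inj,
    ← (Submodule.map_injective_of_injective 𝔫.toSubmodule.injective_subtype).eq_iff,
    map_upperSeries_eq_rootSum b J h𝔫 hψ, map_lowerCentralSeries_eq_rootSum b J h𝔫]
  congr 1
  ext φ
  simp only [Set.mem_ofPred_eq]
  omega

end UpperSeries

lemma nonempty_of_parabolic_ne_top {𝔮 : LieSubalgebra ℂ 𝔤}
    (h𝔮 : 𝔮.toSubmodule = H.toSubmodule ⊔ rootSum {φ : H.root | 0 ≤ b.partialHeight J φ})
    (hne : 𝔮 ≠ ⊤) : J.Nonempty := by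
  rw [Finset.nonempty_iff_ne_empty]
  rintro rfl
  apply hne
  rw [← LieSubalgebra.toSubmodule_inj, h𝔮, LieSubalgebra.top_toSubmodule,
    eq_cartan_sup_rootSum (H := H) (U := ⊤) (fun _ _ _ _ ↦ Submodule.mem_top) le_top]
  congr 2
  ext φ
  simp [RootPairing.Base.partialHeight]

end LeviRoots

end

/-! ### The theorem on the two central series. -/

theorem theorem2p12 {𝔤 : Type*} [LieRing 𝔤] [LieAlgebra ℂ 𝔤] [FiniteDimensional ℂ 𝔤]
    [LieAlgebra.IsSimple ℂ 𝔤]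
    -- a Cartan subalgebra and a set of simple roots
    (H : LieSubalgebra ℂ 𝔤) [H.IsCartanSubalgebra] (b : (rootSystem H).Base)
    -- a proper standard parabolic subalgebra
    (𝔮 : LieSubalgebra ℂ 𝔤) (hb : LeviRoots.borel b ≤ 𝔮.toSubmodule) (hq : 𝔮 ≠ ⊤)
    -- its Levi factor containing the Cartan subalgebra
    (𝔪 : LieSubalgebra ℂ 𝔤) (hm : LeviRoots.IsLeviFactor 𝔮 𝔪) (hH : H ≤ 𝔪)
    -- the highest root
    (ψ : H.root) (hψ : LeviRoots.IsHighestRoot b ψ) :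
    ∃ k : ℕ, (k : ℤ) = ∑ α ∈ LeviRoots.outerSimple b 𝔪, LeviRoots.coeff b ψ α ∧
      (∀ i : ℕ, 2 ≤ i → i ≤ k → ∀ ν : Dual ℂ (LeviRoots.cent 𝔪), LeviRoots.IsTRoot 𝔪 ν →
        LeviRoots.tSpace 𝔪 ν ≤ LeviRoots.graded b 𝔪 i →
        ∃ α ∈ LeviRoots.outerSimple b 𝔪, ∃ μ : Dual ℂ (LeviRoots.cent 𝔪),
          LeviRoots.IsTRoot 𝔪 μ ∧ LeviRoots.tSpace 𝔪 μ ≤ LeviRoots.graded b 𝔪 (i - 1) ∧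
          LeviRoots.bracket (LeviRoots.tSpace 𝔪 (LeviRoots.simpleTRoot b hH α))
            (LeviRoots.tSpace 𝔪 μ) = LeviRoots.tSpace 𝔪 ν) ∧
      (∀ i : ℕ, 2 ≤ i → i ≤ k →
        LeviRoots.bracket (LeviRoots.graded b 𝔪 1) (LeviRoots.graded b 𝔪 (i - 1)) =
          LeviRoots.graded b 𝔪 i) ∧
      (∀ i : ℕ, 1 ≤ i →
        (LeviRoots.lowerSeries (LeviRoots.nil 𝔮) i).toSubmodule.map
            (LeviRoots.nil 𝔮).toSubmodule.subtype =
          ⨆ j ∈ Finset.Icc i k, LeviRoots.graded b 𝔪 j) ∧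
      IsGreatest {i : ℕ | 1 ≤ i ∧ LeviRoots.lowerSeries (LeviRoots.nil 𝔮) i ≠ ⊥} k ∧
      IsLeast {d : ℕ | LeviRoots.upperSeries (LeviRoots.nil 𝔮) d = ⊤} k ∧
      (∀ i : ℕ, 1 ≤ i → i ≤ k →
        LeviRoots.lowerSeries (LeviRoots.nil 𝔮) i =
          LeviRoots.upperSeries (LeviRoots.nil 𝔮) (k - i + 1)) := by
  classical
  obtain ⟨J, h𝔮⟩ := LeviRoots.exists_toSubmodule_eq_of_borel_le b hb
  have hJ := LeviRoots.outerSimple_eq b J h𝔮 hm hH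
  have h𝔪 := LeviRoots.levi_toSubmodule b J h𝔮 hm hH
  have h𝔫 := LeviRoots.nil_toSubmodule b J h𝔮
  have hne := LeviRoots.nonempty_of_parabolic_ne_top b J h𝔮 hq
  have hpos : 0 < b.partialHeight J ψ :=
    Finset.sum_pos (fun α _ ↦ b.rootCoeff_pos_of_maximal hψ α) hne
  obtain ⟨k, hk⟩ := Int.eq_ofNat_of_zero_le hpos.le
  have hmax : ∀ φ : H.root, b.partialHeight J φ ≤ k :=
    fun φ ↦ hk ▸ b.partialHeight_le_of_maximal hψ J φ
  refine ⟨k, ?_, fun i hi _ ν hν hνi ↦ ?_, fun i hi _ ↦ ?_, fun i hi ↦ ?_, ⟨⟨by omega, ?_⟩, ?_⟩,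
    ⟨?_, ?_⟩, fun i hi hik ↦ ?_⟩
  · rw [hJ, ← hk]
    rfl
  · rw [hJ]
    exact LeviRoots.exists_bracket_tSpace_eq b J h𝔪 hH hJ hi hν hνi
  · exact LeviRoots.bracket_graded_one b J h𝔪 hJ hi
  · rw [LeviRoots.iSup_graded b J h𝔪 hJ hi hmax, LeviRoots.lowerSeries,
      LeviRoots.map_lowerCentralSeries_eq_rootSum b J h𝔫]
    congr 1
    ext φ
    simp only [Set.mem_ofPred_eq]
    omega
  · rw [LeviRoots.lowerSeries, Ne, LeviRoots.lowerCentralSeries_eq_bot_iff b J h𝔫]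
    intro h
    have := h ψ
    omega
  · rintro i ⟨hi, hne⟩
    by_contra hlt
    refine hne ((LeviRoots.lowerCentralSeries_eq_bot_iff b J h𝔫 _).2 fun φ ↦ (hmax φ).trans ?_)
    omega
  · exact (LeviRoots.upperSeries_eq_top_iff b J h𝔫 hψ hne k).2 hk.le
  · intro d hd
    have := (LeviRoots.upperSeries_eq_top_iff b J h𝔫 hψ hne d).1 hd
    omega
  -- Numbered from 0, 𝔫^i has index i - 1, and (i - 1) + (k - i + 1) = k: both terms consist of
  -- partial heights ≥ i.
  · exact LeviRoots.lowerCentralSeries_eq_upperSeries b J h𝔫 hψ (by omega)
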